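/- Let $d\ge 1$, let $\mathcal D\subset\mathbb R^d$ be a bounded connected open set with Lipschitz boundary, and let $\alpha,\beta>0$. Let $\mathcal S_{\alpha,\beta}$ be the set of symmetric matrices $M\in\mathbb R^{d\times d}$ such that $\alpha|\xi|^2\le \xi^TM\xi$ and $|\xi^TM\eta|\le\beta|\xi||\eta|$ for all $\xi,\eta\in\mathbb R^d$. Let $A_{\rm per}\in L^\infty(\mathbb R^d,\mathcal S_{\alpha,\beta})$ be $\mathbb Z^d$-periodic, let $\varepsilon>0$, and put $A_\varepsilon(x)=A_{\rm per}(x/\varepsilon)$. Put $L^2_m(\partial\mathcal D)=\{g\in L^2(\partial\mathcal D):\int_{\partial\mathcal D}g=0\}$ and $H^1_m(\mathcal D)=\{u\in H^1(\mathcal D):\int_{\partial\mathcal D}u=0\}$. For $g\in L^2_m(\partial\mathcal D)$ and $A=A_\varepsilon$ or $A=\overline A\in\mathcal S_{\alpha,\beta}$ constant, the problem $-\mathrm{div}(A\nabla u)=0$ in $\mathcal D$, $(A\nabla u)\cdot n=g$ on $\partial\mathcal D$, that is, $$\int_{\mathcal D}\nabla v^TA\nabla u=\int_{\partial\mathcal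 D}g\,v\qquad\text{for all }v\in H^1(\mathcal D),$$ has a unique weak solution $u=u(A,g)\in H^1_m(\mathcal D)$. Define the energy $$\mathcal E(A,g)=\frac12\int_{\mathcal D}\nabla u^TA\nabla u-\int_{\partial\mathcal D}g\,u$$ and, for $\overline A\in\mathcal S_{\alpha,\beta}$, $$\Psi_\varepsilon(\overline A)=\sup\bigl\{|\mathcal E(A_\varepsilon,g)-\mathcal E(\overline A,g)|:\ g\in L^2_m(\partial\mathcal D),\ \|g\|_{L^2(\partial\mathcal D)}=1\bigr\}.$$ Then there exists $\overline A_\varepsilon^{\#}\in\mathcal S_{\alpha,\beta}$ such that $$\Psi_\varepsilon(\overline A_\varepsilon^{\#})=\inf_{\overline A\in\mathcal S_{\alpha,\beta}}\Psi_\varepsilon(\overline A)<\infty.$$ -/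

import Mathlib

open MeasureTheory Filter Topology
open scoped ENNReal NNReal Matrix ContDiff

noncomputable section

namespace EffectiveCoefficient

/-- The bilinear form `ξᵀ M η` of a matrix. -/
def bilin {d : ℕ} (M : Matrix (Fin d) (Fin d) ℝ) (ξ η : EuclideanSpace ℝ (Fin d)) : ℝ :=
  ξ.ofLp ⬝ᵥ (M *ᵥ η.ofLp)

/-- The set `S_{α,β}` of symmetric, `α`-coercive, `β`-bounded matrices. -/
def coeffSet (d : ℕ) (α β : ℝ) : Set (Matrix (Fin d) (Fin d) ℝ) :=
  {M | M.IsSymm ∧ (∀ ξ : EuclideanSpace ℝ (Fin d), α * ‖ξ‖ ^ 2 ≤ bilin M ξ ξ) ∧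
    ∀ ξ η : EuclideanSpace ℝ (Fin d), |bilin M ξ η| ≤ β * ‖ξ‖ * ‖η‖}

/-- Bounded Lipschitz domain: a bounded, connected (in particular nonempty), open set which, near
each boundary point and in suitable orthonormal coordinates, is the strict epigraph of a
Lipschitz function. Here `ν` is the direction of the last coordinate and `(ℝ ∙ ν)ᗮ` is the
hyperplane of the remaining ones. -/
structure IsLipschitzDomain {d : ℕ} (D : Set (EuclideanSpace ℝ (Fin d))) : Prop where
  isOpen : IsOpen D
  isConnected : IsConnected D
  isBounded : Bornology.IsBounded D
  local_epigraph : ∀ x₀ ∈ frontier D, ∃ ν : EuclideanSpace ℝ (Fin d), ‖ν‖ = 1 ∧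
    ∃ (K : ℝ≥0) (γ : (Submodule.span ℝ {ν})ᗮ → ℝ), LipschitzWith K γ ∧
      ∃ r > 0, ∀ y ∈ Metric.ball x₀ r,
        (y ∈ D ↔ γ ((Submodule.span ℝ {ν})ᗮ.orthogonalProjectionOnto y) < inner ℝ ν y)

/-- Lebesgue measure on `D`. -/
abbrev bulk {d : ℕ} (D : Set (EuclideanSpace ℝ (Fin d))) : Measure (EuclideanSpace ℝ (Fin d)) :=
  volume.restrict D

/-- Surface measure on `∂D`: the `(d-1)`-dimensional Hausdorff measure, with the normalization
that makes it agree with Lebesgue measure on hyperplanes. -/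
abbrev surf {d : ℕ} (D : Set (EuclideanSpace ℝ (Fin d))) : Measure (EuclideanSpace ℝ (Fin d)) :=
  (Measure.euclideanHausdorffMeasure (d - 1)).restrict (frontier D)

/-- `G` is the weak (distributional) gradient of `u` in `D`. -/
def HasWeakGradient {d : ℕ} (D : Set (EuclideanSpace ℝ (Fin d)))
    (u : EuclideanSpace ℝ (Fin d) → ℝ)
    (G : EuclideanSpace ℝ (Fin d) → EuclideanSpace ℝ (Fin d)) : Prop :=
  ∀ φ : EuclideanSpace ℝ (Fin d) → ℝ, ContDiff ℝ ∞ φ → HasCompactSupport φ → tsupport φ ⊆ D →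
    ∀ i : Fin d, ∫ x in D, u x * gradient φ x i = -∫ x in D, G x i * φ x

/-- `t ∈ L²(∂D)` is the boundary trace of the `H¹(D)` function `u` with gradient `G`: the trace is
the continuous extension to `H¹(D)` of the restriction to `∂D` of functions smooth up to the
boundary, so `t` is the `L²(∂D)` limit of `φ n` on `∂D` for smooth `φ n` that converge to `u` in
`H¹(D)`. -/
def IsTrace {d : ℕ} (D : Set (EuclideanSpace ℝ (Fin d)))
    (u : EuclideanSpace ℝ (Fin d) → ℝ)
    (G : EuclideanSpace ℝ (Fin d) → EuclideanSpace ℝ (Fin d))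
    (t : EuclideanSpace ℝ (Fin d) → ℝ) : Prop :=
  ∃ φ : ℕ → EuclideanSpace ℝ (Fin d) → ℝ, (∀ n, ContDiff ℝ ∞ (φ n)) ∧
    Tendsto (fun n => eLpNorm (fun x => φ n x - u x) 2 (bulk D)) atTop (𝓝 0) ∧
    Tendsto (fun n => eLpNorm (fun x => gradient (φ n) x - G x) 2 (bulk D)) atTop (𝓝 0) ∧
    Tendsto (fun n => eLpNorm (fun x => φ n x - t x) 2 (surf D)) atTop (𝓝 0)

/-- An element of `H¹(D)`, with representatives of its weak gradient and of its trace on `∂D`.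
(In a bounded Lipschitz domain every `u ∈ L²(D)` with weak gradient in `L²(D)` has exactly one
trace up to null sets, so carrying the trace along is no restriction.) -/
structure H1 {d : ℕ} (D : Set (EuclideanSpace ℝ (Fin d))) where
  toFun : EuclideanSpace ℝ (Fin d) → ℝ
  grad : EuclideanSpace ℝ (Fin d) → EuclideanSpace ℝ (Fin d)
  trace : EuclideanSpace ℝ (Fin d) → ℝ
  memLp_toFun : MemLp toFun 2 (bulk D)
  memLp_grad : MemLp grad 2 (bulk D)
  memLp_trace : MemLp trace 2 (surf D)
  hasWeakGradient : HasWeakGradient D toFun grad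
  isTrace : IsTrace D toFun grad trace

/-- `L²_m(∂D)`: square integrable functions on `∂D` with zero mean. -/
def L2m {d : ℕ} (D : Set (EuclideanSpace ℝ (Fin d))) : Set (Lp ℝ 2 (surf D)) :=
  {g | ∫ x, g x ∂(surf D) = 0}

/-- `u` is the weak solution in `H¹_m(D)` (zero mean on `∂D`) of `-div (A ∇u) = 0` in `D`,
`(A ∇u) · n = g` on `∂D`. -/
def IsNeumannSolution {d : ℕ} (D : Set (EuclideanSpace ℝ (Fin d)))
    (A : EuclideanSpace ℝ (Fin d) → Matrix (Fin d) (Fin d) ℝ) (g : Lp ℝ 2 (surf D))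
    (u : H1 D) : Prop :=
  ∫ x, u.trace x ∂(surf D) = 0 ∧
  ∀ v : H1 D, ∫ x in D, bilin (A x) (v.grad x) (u.grad x) = ∫ x, g x * v.trace x ∂(surf D)

/-- Existence and uniqueness of the weak solution in `H¹_m(D)`. -/
def WellPosed {d : ℕ} (D : Set (EuclideanSpace ℝ (Fin d)))
    (A : EuclideanSpace ℝ (Fin d) → Matrix (Fin d) (Fin d) ℝ) (g : Lp ℝ 2 (surf D)) : Prop :=
  ∃ u : H1 D, IsNeumannSolution D A g u ∧
    ∀ w : H1 D, IsNeumannSolution D A g w → w.toFun =ᵐ[bulk D] u.toFun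

open Classical in
/-- The energy `E(A,g) = ½ ∫_D ∇uᵀ A ∇u - ∫_{∂D} g u`, where `u` is the weak solution
(the default value `0` is used if there is none). -/
def energy {d : ℕ} (D : Set (EuclideanSpace ℝ (Fin d)))
    (A : EuclideanSpace ℝ (Fin d) → Matrix (Fin d) (Fin d) ℝ) (g : Lp ℝ 2 (surf D)) : ℝ :=
  if h : ∃ u : H1 D, IsNeumannSolution D A g u then
    (1 / 2) * (∫ x in D, bilin (A x) (h.choose.grad x) (h.choose.grad x))
      - ∫ x, g x * h.choose.trace x ∂(surf D)
  else 0

/-- `Ψ(Ā) = sup { |E(A,g) - E(Ā,g)| : g ∈ L²_m(∂D), ‖g‖ = 1 } ∈ [0,∞]`, for a given coefficient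
field `A` and a constant coefficient `Ā`. -/
def Psi {d : ℕ} (D : Set (EuclideanSpace ℝ (Fin d)))
    (A : EuclideanSpace ℝ (Fin d) → Matrix (Fin d) (Fin d) ℝ)
    (Abar : Matrix (Fin d) (Fin d) ℝ) : ℝ≥0∞ :=
  ⨆ g ∈ {g : Lp ℝ 2 (surf D) | g ∈ L2m D ∧ ‖g‖ = 1},
    ENNReal.ofReal |energy D A g - energy D (fun _ => Abar) g|

/-- `A_per ∈ L^∞(ℝ^d, S_{α,β})` and `A_per` is `ℤ^d`-periodic (as an element of `L^∞`). -/
structure IsPeriodicCoeff {d : ℕ} (α β : ℝ)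
    (Aper : EuclideanSpace ℝ (Fin d) → Matrix (Fin d) (Fin d) ℝ) : Prop where
  aemeasurable : ∀ i j, AEMeasurable (fun x => Aper x i j) volume
  mem_coeffSet : ∀ᵐ x, Aper x ∈ coeffSet d α β
  periodic : ∀ k : Fin d → ℤ,
    (fun x => Aper (x + WithLp.toLp 2 (fun i => (k i : ℝ)))) =ᵐ[volume] Aper

/-- The rescaled coefficient `A_ε(x) = A_per(x/ε)`. -/
def rescale {d : ℕ} (Aper : EuclideanSpace ℝ (Fin d) → Matrix (Fin d) (Fin d) ℝ) (ε : ℝ) :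
    EuclideanSpace ℝ (Fin d) → Matrix (Fin d) (Fin d) ℝ :=
  fun x => Aper (ε⁻¹ • x)

end EffectiveCoefficient

end

/-!
`H¹(D)` is realized as the closure of the triples `(φ, ∇φ, φ|∂D)`, `φ` smooth, in the Hilbert space
`L²(D) × L²(D; ℝᵈ) × L²(∂D)`. On a convex set the Poincaré inequality follows by averaging
`|φ x - φ y|` along segments. Since a Lipschitz domain can be pushed into itself near each boundary
point, the inequality extends to a neighbourhood of that point, and by connectedness of the closure
these local inequalities add up to a global one. Integrating `φ` over the segments that leave the
graph `∂D` transversally bounds its trace by its `H¹` norm. So `‖∇u‖` is an equivalent norm on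
the functions in `H¹(D)` with mean zero on `∂D`, and Lax–Milgram gives weak solutions with
`‖u‖ ≤ C ‖g‖`, where `C` depends on the coefficient only through `α`.

Testing the equations of two solutions `u`, `w`, for the coefficients `A`, `B`, against each other
gives, by symmetry, `E(A,g) - E(B,g) = ½ ∫ ∇uᵀ (A - B) ∇w`. So `E(Ā,g)` is continuous in `Ā`, and
`Ψ` is finite and, being a supremum of continuous functions, lower semicontinuous. Hence it attains
its infimum on the compact set `S_{α,β}`.
-/

noncomputable section

namespace EffectiveCoefficient

section Increment

theorem lintegral_rpow_le {X : Type*} [MeasurableSpace X] {μ : Measure X} {f : X → ℝ≥0∞}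
    (hf : AEMeasurable f μ) {p : ℝ} (hp : 1 ≤ p) :
    (∫⁻ x, f x ∂μ) ^ p ≤ μ Set.univ ^ (p - 1) * ∫⁻ x, f x ^ p ∂μ := by
  have hp₀ : 0 < p := zero_lt_one.trans_le hp
  have h := eLpNorm'_le_eLpNorm'_mul_rpow_measure_univ one_pos hp hf.aestronglyMeasurable
  simp only [eLpNorm'_eq_lintegral_enorm, enorm_eq_self, ENNReal.rpow_one, div_one] at h
  calc (∫⁻ x, f x ∂μ) ^ p
      ≤ ((∫⁻ x, f x ^ p ∂μ) ^ (1 / p) * μ Set.univ ^ (1 - 1 / p)) ^ p := by gcongr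
    _ = μ Set.univ ^ (p - 1) * ∫⁻ x, f x ^ p ∂μ := by
        rw [ENNReal.mul_rpow_of_nonneg _ _ hp₀.le, ← ENNReal.rpow_mul, ← ENNReal.rpow_mul,
          one_div_mul_cancel hp₀.ne', ENNReal.rpow_one, sub_mul, one_mul,
          one_div_mul_cancel hp₀.ne', mul_comm]

theorem setLIntegral_comp_add_right_le {G : Type*} [AddGroup G] [MeasurableSpace G]
    [MeasurableAdd G] {μ : Measure G} [μ.IsAddRightInvariant] {D S : Set G} {v : G}
    (hSD : ∀ y ∈ S, y + v ∈ D) (f : G → ℝ≥0∞) :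
    ∫⁻ y in S, f (y + v) ∂μ ≤ ∫⁻ x in D, f x ∂μ :=
  (lintegral_mono_set hSD).trans_eq <|
    (measurePreserving_add_right μ v).setLIntegral_comp_preimage_emb
      (measurableEmbedding_addRight v) f D

variable {E F : Type*} [NormedAddCommGroup E] [NormedSpace ℝ E] [NormedAddCommGroup F]
  [NormedSpace ℝ F] [CompleteSpace F] {φ : E → F}

theorem enorm_add_smul_sub_le (hφ : ContDiff ℝ 1 φ) (y v : E) {t : ℝ} (ht : 0 ≤ t) :
    ‖φ (y + t • v) - φ y‖ₑ ≤ ‖v‖ₑ * ∫⁻ s in Set.Ioo 0 t, ‖fderiv ℝ φ (y + s • v)‖ₑ := by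
  have hcont : Continuous fun s : ℝ => fderiv ℝ φ (y + s • v) :=
    (hφ.continuous_fderiv (by simp)).comp (by fun_prop)
  have hderiv (s : ℝ) : HasDerivAt (fun s : ℝ => φ (y + s • v)) (fderiv ℝ φ (y + s • v) v) s := by
    have hline : HasDerivAt (fun s : ℝ => y + s • v) v s := by
      simpa using ((hasDerivAt_id s).smul_const v).const_add y
    exact (hφ.differentiable (by simp)).differentiableAt.hasFDerivAt.comp_hasDerivAt s hline
  have hftc := intervalIntegral.integral_eq_sub_of_hasDerivAt (fun s _ => hderiv s)
    ((hcont.clm_apply continuous_const).intervalIntegrable 0 t)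
  rw [zero_smul, add_zero, intervalIntegral.integral_of_le ht, integral_Ioc_eq_integral_Ioo]
    at hftc
  rw [← hftc, ← lintegral_const_mul _ hcont.enorm.measurable]
  refine (enorm_integral_le_lintegral_enorm _).trans (lintegral_mono fun s => ?_)
  rw [mul_comm]
  exact ContinuousLinearMap.le_opENorm _ _

theorem enorm_add_smul_sub_rpow_le (hφ : ContDiff ℝ 1 φ) (y v : E) {t : ℝ} (ht : 0 ≤ t) {p : ℝ}
    (hp : 1 ≤ p) :
    ‖φ (y + t • v) - φ y‖ₑ ^ p ≤ ‖v‖ₑ ^ p * ENNReal.ofReal t ^ (p - 1) *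
      ∫⁻ s in Set.Ioo 0 t, ‖fderiv ℝ φ (y + s • v)‖ₑ ^ p := by
  have hcont : Continuous fun s : ℝ => fderiv ℝ φ (y + s • v) :=
    (hφ.continuous_fderiv (by simp)).comp (by fun_prop)
  have hp₀ : 0 ≤ p := zero_le_one.trans hp
  calc ‖φ (y + t • v) - φ y‖ₑ ^ p
      ≤ (‖v‖ₑ * ∫⁻ s in Set.Ioo 0 t, ‖fderiv ℝ φ (y + s • v)‖ₑ) ^ p := by
        gcongr
        exact enorm_add_smul_sub_le hφ y v ht
    _ ≤ ‖v‖ₑ ^ p * (ENNReal.ofReal t ^ (p - 1) *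
          ∫⁻ s in Set.Ioo 0 t, ‖fderiv ℝ φ (y + s • v)‖ₑ ^ p) := by
        rw [ENNReal.mul_rpow_of_nonneg _ _ hp₀]
        gcongr
        simpa using lintegral_rpow_le (μ := volume.restrict (Set.Ioo 0 t))
          hcont.enorm.measurable.aemeasurable hp
    _ = _ := (mul_assoc _ _ _).symm

variable [FiniteDimensional ℝ E] [MeasurableSpace E] [BorelSpace E] {μ : Measure E}
  [μ.IsAddHaarMeasure]

theorem setLIntegral_enorm_add_sub_rpow_le (hφ : ContDiff ℝ 1 φ) {p : ℝ} (hp : 1 ≤ p)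
    {D S : Set E} {v : E} (hSD : ∀ y ∈ S, ∀ t ∈ Set.Ioo (0 : ℝ) 1, y + t • v ∈ D) :
    ∫⁻ y in S, ‖φ (y + v) - φ y‖ₑ ^ p ∂μ ≤ ‖v‖ₑ ^ p * ∫⁻ x in D, ‖fderiv ℝ φ x‖ₑ ^ p ∂μ := by
  have hderiv : Measurable fun x => ‖fderiv ℝ φ x‖ₑ ^ p :=
    (hφ.continuous_fderiv (by simp)).enorm.measurable.pow_const p
  have hmeas : Measurable fun q : E × ℝ => ‖fderiv ℝ φ (q.1 + q.2 • v)‖ₑ ^ p :=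
    hderiv.comp (by fun_prop)
  calc ∫⁻ y in S, ‖φ (y + v) - φ y‖ₑ ^ p ∂μ
      ≤ ∫⁻ y in S, ‖v‖ₑ ^ p * (∫⁻ t in Set.Ioo (0 : ℝ) 1, ‖fderiv ℝ φ (y + t • v)‖ₑ ^ p) ∂μ :=
        lintegral_mono fun y => by
          simpa using enorm_add_smul_sub_rpow_le hφ y v zero_le_one hp
    _ = ‖v‖ₑ ^ p * ∫⁻ t in Set.Ioo (0 : ℝ) 1, ∫⁻ y in S, ‖fderiv ℝ φ (y + t • v)‖ₑ ^ p ∂μ := by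
        rw [lintegral_const_mul _ hmeas.lintegral_prod_right',
          lintegral_lintegral_swap hmeas.aemeasurable]
    _ ≤ ‖v‖ₑ ^ p * ∫⁻ _ in Set.Ioo (0 : ℝ) 1, ∫⁻ x in D, ‖fderiv ℝ φ x‖ₑ ^ p ∂μ := by
        refine mul_le_mul_right (setLIntegral_mono' measurableSet_Ioo fun t ht => ?_) _
        exact setLIntegral_comp_add_right_le (fun y hy => hSD y hy t ht)
          fun x => ‖fderiv ℝ φ x‖ₑ ^ p
    _ = ‖v‖ₑ ^ p * ∫⁻ x in D, ‖fderiv ℝ φ x‖ₑ ^ p ∂μ := by simp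

end Increment

theorem exists_isOpen_superset_of_isPreconnected {X : Type*} [TopologicalSpace X] {K : Set X}
    (hK : IsCompact K) (hKc : IsPreconnected K) (hKne : K.Nonempty) {P : Set X → Prop}
    (hlocal : ∀ x ∈ K, ∃ S, IsOpen S ∧ x ∈ S ∧ P S)
    (hunion : ∀ S T, IsOpen S → IsOpen T → (K ∩ (S ∩ T)).Nonempty → P S → P T → P (S ∪ T)) :
    ∃ S, IsOpen S ∧ K ⊆ S ∧ P S := by
  have hpair : ∀ x ∈ K, ∀ y ∈ K, ∃ S, IsOpen S ∧ x ∈ S ∧ y ∈ S ∧ P S := by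
    intro x hx y hy
    refine hKc.induction₂ (fun x y => ∃ S, IsOpen S ∧ x ∈ S ∧ y ∈ S ∧ P S) ?_ ?_ ?_ hx hy
    · intro x hx
      obtain ⟨S, hS, hxS, hPS⟩ := hlocal x hx
      filter_upwards [mem_nhdsWithin_of_mem_nhds (hS.mem_nhds hxS)] with y hy
      exact ⟨S, hS, hxS, hy, hPS⟩
    · rintro x y z - hy - ⟨S, hS, hxS, hyS, hPS⟩ ⟨T, hT, hyT, hzT, hPT⟩
      exact ⟨S ∪ T, hS.union hT, Or.inl hxS, Or.inr hzT,
        hunion S T hS hT ⟨y, hy, hyS, hyT⟩ hPS hPT⟩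
    · rintro x y - - ⟨S, hS, hxS, hyS, hPS⟩
      exact ⟨S, hS, hyS, hxS, hPS⟩
  obtain ⟨x₀, hx₀⟩ := hKne
  obtain ⟨S, hS, -, hKS, hPS⟩ : ∃ S, IsOpen S ∧ x₀ ∈ S ∧ K ⊆ S ∧ P S := by
    refine hK.induction_on (p := fun L => ∃ S, IsOpen S ∧ x₀ ∈ S ∧ L ⊆ S ∧ P S) ?_ ?_ ?_ ?_
    · obtain ⟨S, hS, hxS, -, hPS⟩ := hpair x₀ hx₀ x₀ hx₀
      exact ⟨S, hS, hxS, S.empty_subset, hPS⟩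
    · rintro L M hLM ⟨S, hS, hxS, hMS, hPS⟩
      exact ⟨S, hS, hxS, hLM.trans hMS, hPS⟩
    · rintro L M ⟨S, hS, hxS, hLS, hPS⟩ ⟨T, hT, hxT, hMT, hPT⟩
      exact ⟨S ∪ T, hS.union hT, Or.inl hxS, Set.union_subset_union hLS hMT,
        hunion S T hS hT ⟨x₀, hx₀, hxS, hxT⟩ hPS hPT⟩
    · intro x hx
      obtain ⟨S, hS, hxS₀, hxS, hPS⟩ := hpair x₀ hx₀ x hx
      exact ⟨S, mem_nhdsWithin_of_mem_nhds (hS.mem_nhds hxS), S, hS, hxS₀, le_rfl, hPS⟩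
  exact ⟨S, hS, hKS, hPS⟩

section LpSeminorm

variable {X G : Type*} [MeasurableSpace X] [NormedAddCommGroup G] {p : ℝ≥0}

theorem eLpNorm_le_of_lintegral_rpow_le {μ : Measure X} {f : X → G} (hp : p ≠ 0) {b : ℝ≥0∞}
    (h : ∫⁻ x, ‖f x‖ₑ ^ (p : ℝ) ∂μ ≤ b ^ (p : ℝ)) : eLpNorm f p μ ≤ b := by
  rwa [← eLpNorm_nnreal_pow_eq_lintegral hp,
    ENNReal.rpow_le_rpow_iff (NNReal.coe_pos.2 (pos_iff_ne_zero.2 hp))] at h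

theorem eLpNorm_restrict_union_le (hp : 1 ≤ p) (μ : Measure X) (f : X → G) (S T : Set X) :
    eLpNorm f p (μ.restrict (S ∪ T)) ≤
      eLpNorm f p (μ.restrict S) + eLpNorm f p (μ.restrict T) := by
  have hp₀ : p ≠ 0 := (zero_lt_one.trans_le hp).ne'
  refine eLpNorm_le_of_lintegral_rpow_le hp₀ ((lintegral_union_le _ S T).trans ?_)
  rw [← eLpNorm_nnreal_pow_eq_lintegral hp₀, ← eLpNorm_nnreal_pow_eq_lintegral hp₀]
  exact ENNReal.add_rpow_le_rpow_add _ _ (by exact_mod_cast hp)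

theorem eLpNorm_sub_const_restrict_le (hp : 1 ≤ p) {μ : Measure X} {f : X → G}
    (hf : AEStronglyMeasurable f μ) {S T : Set X} (hST : S ⊆ T) (hS : μ S ≠ 0) (hT : μ T ≠ ⊤)
    (a b : G) :
    eLpNorm (fun x => f x - a) p (μ.restrict T) ≤
      eLpNorm (fun x => f x - b) p (μ.restrict T) + (μ T / μ S) ^ (1 / (p : ℝ)) *
        (eLpNorm (fun x => f x - b) p (μ.restrict T) +
          eLpNorm (fun x => f x - a) p (μ.restrict S)) := by
  have hp₀ : (p : ℝ≥0∞) ≠ 0 := by exact_mod_cast (zero_lt_one.trans_le hp).ne'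
  have hp₁ : (1 : ℝ≥0∞) ≤ p := by exact_mod_cast hp
  have hmeas (c : G) (U : Set X) : AEStronglyMeasurable (fun x => f x - c) (μ.restrict U) :=
    hf.restrict.sub aestronglyMeasurable_const
  have hS_le : eLpNorm (fun _ => b - a) p (μ.restrict S) ≤
      eLpNorm (fun x => f x - b) p (μ.restrict T) + eLpNorm (fun x => f x - a) p (μ.restrict S) :=
    calc eLpNorm (fun _ => b - a) p (μ.restrict S)
        = eLpNorm ((fun x => f x - a) - fun x => f x - b) p (μ.restrict S) := by
          congr 1; ext x; simp
      _ ≤ eLpNorm (fun x => f x - b) p (μ.restrict S) +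
          eLpNorm (fun x => f x - a) p (μ.restrict S) := by
          rw [add_comm]; exact eLpNorm_sub_le (hmeas a S) (hmeas b S) hp₁
      _ ≤ _ := by
          gcongr
  have hT_eq : eLpNorm (fun _ => b - a) p (μ.restrict T) =
      (μ T / μ S) ^ (1 / (p : ℝ)) * eLpNorm (fun _ => b - a) p (μ.restrict S) := by
    rw [eLpNorm_const' _ hp₀ ENNReal.coe_ne_top, eLpNorm_const' _ hp₀ ENNReal.coe_ne_top,
      Measure.restrict_apply_univ, Measure.restrict_apply_univ, ENNReal.coe_toReal, mul_left_comm,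
      ← ENNReal.mul_rpow_of_nonneg _ _ (by positivity),
      ENNReal.div_mul_cancel hS (measure_ne_top_of_subset hST hT)]
  calc eLpNorm (fun x => f x - a) p (μ.restrict T)
      = eLpNorm ((fun x => f x - b) + fun _ => b - a) p (μ.restrict T) := by
        congr 1; ext x; simp
    _ ≤ eLpNorm (fun x => f x - b) p (μ.restrict T) + eLpNorm (fun _ => b - a) p (μ.restrict T) :=
        eLpNorm_add_le (hmeas b T) aestronglyMeasurable_const hp₁
    _ ≤ _ := by
        rw [hT_eq]
        gcongr

end LpSeminorm

section Poincare

variable {E F : Type*} [NormedAddCommGroup E] [NormedSpace ℝ E] [FiniteDimensional ℝ E]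
  [MeasurableSpace E] [BorelSpace E] {μ : Measure E} [NormedAddCommGroup F] [NormedSpace ℝ F]
  {p : ℝ≥0} {D S T U : Set E}

variable (F μ p D S) in
/-- The `Lᵖ` Poincaré inequality on `S ∩ D` for functions with values in `F`. The derivative is
taken over all of `D`, so that a part `S` of `D` may be joined to another one through `D`. -/
def PoincareOn : Prop :=
  ∃ C : ℝ≥0, ∀ φ : E → F, ContDiff ℝ 1 φ → ∃ c : F,
    eLpNorm (fun x => φ x - c) p (μ.restrict (S ∩ D)) ≤
      C * eLpNorm (fderiv ℝ φ) p (μ.restrict D)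

theorem PoincareOn.union (hp : 1 ≤ p) (hT : μ (T ∩ D) ≠ ⊤) (hST : μ (S ∩ T ∩ D) ≠ 0)
    (hPS : PoincareOn F μ p D S) (hPT : PoincareOn F μ p D T) :
    PoincareOn F μ p D (S ∪ T) := by
  obtain ⟨C₁, hC₁⟩ := hPS
  obtain ⟨C₂, hC₂⟩ := hPT
  set q : ℝ≥0∞ := (μ (T ∩ D) / μ (S ∩ T ∩ D)) ^ (1 / (p : ℝ))
  have hq : q ≠ ⊤ := ENNReal.rpow_ne_top_of_nonneg (by positivity) (ENNReal.div_ne_top hT hST)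
  refine ⟨C₁ + (C₂ + q.toNNReal * (C₂ + C₁)), fun φ hφ => ?_⟩
  obtain ⟨c₁, hc₁⟩ := hC₁ φ hφ
  obtain ⟨c₂, hc₂⟩ := hC₂ φ hφ
  set I := eLpNorm (fderiv ℝ φ) p (μ.restrict D)
  have hc₁' : eLpNorm (fun x => φ x - c₁) p (μ.restrict (S ∩ T ∩ D)) ≤ C₁ * I :=
    (eLpNorm_mono_measure _ (Measure.restrict_mono (by grind) le_rfl)).trans hc₁
  refine ⟨c₁, ?_⟩
  rw [Set.union_inter_distrib_right]
  calc eLpNorm (fun x => φ x - c₁) p (μ.restrict (S ∩ D ∪ T ∩ D))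
      ≤ eLpNorm (fun x => φ x - c₁) p (μ.restrict (S ∩ D)) +
        eLpNorm (fun x => φ x - c₁) p (μ.restrict (T ∩ D)) := eLpNorm_restrict_union_le hp μ _ _ _
    _ ≤ C₁ * I + (C₂ * I + q * (C₂ * I + C₁ * I)) := by
        gcongr
        refine (eLpNorm_sub_const_restrict_le hp hφ.continuous.aestronglyMeasurable
          (by grind) hST hT c₁ c₂).trans ?_
        gcongr
    _ = _ := by
        push_cast
        rw [ENNReal.coe_toNNReal hq]
        ring

variable [CompleteSpace F]

theorem setLIntegral_setLIntegral_enorm_sub_rpow_le [μ.IsAddHaarMeasure] {φ : E → F}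
    (hφ : ContDiff ℝ 1 φ) {p : ℝ} (hp : 1 ≤ p) (hU : Convex ℝ U) (hUm : MeasurableSet U) {R : ℝ}
    (hUR : ∀ x ∈ U, ∀ y ∈ U, x - y ∈ Metric.ball 0 R) :
    ∫⁻ y in U, ∫⁻ x in U, ‖φ x - φ y‖ₑ ^ p ∂μ ∂μ ≤
      μ (Metric.ball 0 R) * (ENNReal.ofReal R ^ p * ∫⁻ x in U, ‖fderiv ℝ φ x‖ₑ ^ p ∂μ) := by
  set B : Set E := Metric.ball 0 R
  have hφc := hφ.continuous
  set f : E → E → ℝ≥0∞ := fun y x => U.indicator (fun x => ‖φ x - φ y‖ₑ ^ p) x with hf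
  have hfm : Measurable fun q : E × E => f q.1 (q.2 + q.1) := by
    have hinc : Measurable fun q : E × E => ‖φ (q.2 + q.1) - φ q.1‖ₑ ^ p :=
      (by fun_prop : Continuous fun q : E × E => φ (q.2 + q.1) - φ q.1).enorm.measurable.pow_const p
    exact hinc.indicator (measurable_snd.add measurable_fst hUm)
  calc ∫⁻ y in U, ∫⁻ x in U, ‖φ x - φ y‖ₑ ^ p ∂μ ∂μ
      ≤ ∫⁻ y in U, ∫⁻ v in B, f y (v + y) ∂μ ∂μ := by
        refine setLIntegral_mono' hUm fun y hy => ?_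
        refine le_of_eq_of_le (setLIntegral_congr_fun hUm fun x hx => ?_)
          (setLIntegral_comp_add_right_le (v := -y) (S := U)
            (fun x hx => by simpa [sub_eq_add_neg] using hUR x hx y hy) fun v => f y (v + y))
        simp [hf, hx]
    _ = ∫⁻ v in B, ∫⁻ y in U, f y (v + y) ∂μ ∂μ := lintegral_lintegral_swap hfm.aemeasurable
    _ ≤ ∫⁻ _ in B, ENNReal.ofReal R ^ p * ∫⁻ x in U, ‖fderiv ℝ φ x‖ₑ ^ p ∂μ ∂μ := by
        refine setLIntegral_mono' measurableSet_ball fun v hv => ?_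
        have hUv : MeasurableSet ((v + ·) ⁻¹' U) := measurable_const_add v hUm
        calc ∫⁻ y in U, f y (v + y) ∂μ
            = ∫⁻ y in (v + ·) ⁻¹' U ∩ U, ‖φ (y + v) - φ y‖ₑ ^ p ∂μ := by
              rw [← Measure.restrict_restrict hUv, ← lintegral_indicator hUv]
              refine lintegral_congr fun y => ?_
              by_cases hy : v + y ∈ U <;> simp [hf, hy, add_comm y v]
          _ ≤ ‖v‖ₑ ^ p * ∫⁻ x in U, ‖fderiv ℝ φ x‖ₑ ^ p ∂μ :=
              setLIntegral_enorm_add_sub_rpow_le hφ hp fun y hy t ht =>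
                hU.add_smul_mem hy.2 (by simpa [add_comm] using hy.1) ⟨ht.1.le, ht.2.le⟩
          _ ≤ _ := by
              gcongr
              rw [← ofReal_norm]
              exact ENNReal.ofReal_le_ofReal (mem_ball_zero_iff.1 hv).le
    _ = _ := by rw [setLIntegral_const, mul_comm]

theorem poincareOn_of_convex [μ.IsAddHaarMeasure] (hp : 1 ≤ p) (hU : Convex ℝ U)
    (hUo : IsOpen U) (hUne : U.Nonempty) (hUb : Bornology.IsBounded U) (hUD : U ⊆ D) :
    PoincareOn F μ p D U := by
  have hp₀ : p ≠ 0 := (zero_lt_one.trans_le hp).ne'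
  have hp₁ : (1 : ℝ) ≤ p := by exact_mod_cast hp
  obtain ⟨R, hR⟩ : ∃ R, ∀ x ∈ U, ∀ y ∈ U, x - y ∈ Metric.ball 0 R := by
    obtain ⟨R, hR⟩ := (hUb.sub hUb).subset_ball 0
    exact ⟨R, fun x hx y hy => hR (Set.sub_mem_sub hx hy)⟩
  have hU₀ : μ U ≠ 0 := (hUo.measure_pos μ hUne).ne'
  set K : ℝ≥0∞ := μ (Metric.ball 0 R) * ENNReal.ofReal R ^ (p : ℝ) / μ U with hK
  have hK_top : K ≠ ⊤ := ENNReal.div_ne_top (ENNReal.mul_ne_top measure_ball_lt_top.ne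
    (ENNReal.rpow_ne_top_of_nonneg (by positivity) ENNReal.ofReal_ne_top)) hU₀
  refine ⟨(K ^ (1 / (p : ℝ))).toNNReal, fun φ hφ => ?_⟩
  rw [ENNReal.coe_toNNReal (ENNReal.rpow_ne_top_of_nonneg (by positivity) hK_top)]
  have hmeas : Measurable fun q : E × E => ‖φ q.2 - φ q.1‖ₑ ^ (p : ℝ) :=
    ((hφ.continuous.comp continuous_snd).sub
      (hφ.continuous.comp continuous_fst)).enorm.measurable.pow_const _
  obtain ⟨y, -, hy⟩ := exists_le_setLAverage (μ := μ) hU₀ hUb.measure_lt_top.ne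
    (f := fun y => ∫⁻ x in U, ‖φ x - φ y‖ₑ ^ (p : ℝ) ∂μ) hmeas.lintegral_prod_right'.aemeasurable
  refine ⟨φ y, eLpNorm_le_of_lintegral_rpow_le hp₀ ?_⟩
  rw [ENNReal.mul_rpow_of_nonneg _ _ p.coe_nonneg, ← ENNReal.rpow_mul,
    one_div_mul_cancel (by exact_mod_cast hp₀), ENNReal.rpow_one,
    eLpNorm_nnreal_pow_eq_lintegral hp₀, Set.inter_eq_left.2 hUD]
  calc ∫⁻ x in U, ‖φ x - φ y‖ₑ ^ (p : ℝ) ∂μ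
      ≤ (∫⁻ y in U, ∫⁻ x in U, ‖φ x - φ y‖ₑ ^ (p : ℝ) ∂μ ∂μ) / μ U := by rwa [← setLAverage_eq]
    _ ≤ μ (Metric.ball 0 R) * (ENNReal.ofReal R ^ (p : ℝ) *
          ∫⁻ x in U, ‖fderiv ℝ φ x‖ₑ ^ (p : ℝ) ∂μ) / μ U := by
        gcongr
        exact setLIntegral_setLIntegral_enorm_sub_rpow_le hφ hp₁ hU hUo.measurableSet hR
    _ = K * ∫⁻ x in U, ‖fderiv ℝ φ x‖ₑ ^ (p : ℝ) ∂μ := by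
        rw [← mul_assoc, hK, ENNReal.mul_div_right_comm]
    _ ≤ K * ∫⁻ x in D, ‖fderiv ℝ φ x‖ₑ ^ (p : ℝ) ∂μ := by gcongr

theorem PoincareOn.of_add_mem [μ.IsAddHaarMeasure] (hp : 1 ≤ p) (hT : PoincareOn F μ p D T)
    {v : E} (hST : ∀ y ∈ S ∩ D, y + v ∈ T)
    (hseg : ∀ y ∈ S ∩ D, ∀ t ∈ Set.Ioc (0 : ℝ) 1, y + t • v ∈ D) : PoincareOn F μ p D S := by
  have hp₀ : p ≠ 0 := (zero_lt_one.trans_le hp).ne'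
  obtain ⟨C, hC⟩ := hT
  refine ⟨‖v‖₊ + C, fun φ hφ => ?_⟩
  obtain ⟨c, hc⟩ := hC φ hφ
  have hφc := hφ.continuous
  refine ⟨c, ?_⟩
  have hinc : eLpNorm (fun y => φ (y + v) - φ y) p (μ.restrict (S ∩ D)) ≤
      ‖v‖ₑ * eLpNorm (fderiv ℝ φ) p (μ.restrict D) := by
    refine eLpNorm_le_of_lintegral_rpow_le hp₀ ?_
    rw [ENNReal.mul_rpow_of_nonneg _ _ p.coe_nonneg, eLpNorm_nnreal_pow_eq_lintegral hp₀]
    exact setLIntegral_enorm_add_sub_rpow_le hφ (by exact_mod_cast hp) fun y hy t ht =>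
      hseg y hy t ⟨ht.1, ht.2.le⟩
  have htrans : eLpNorm (fun y => φ (y + v) - c) p (μ.restrict (S ∩ D)) ≤
      eLpNorm (fun x => φ x - c) p (μ.restrict (T ∩ D)) := by
    refine eLpNorm_le_of_lintegral_rpow_le hp₀ ?_
    rw [eLpNorm_nnreal_pow_eq_lintegral hp₀]
    exact setLIntegral_comp_add_right_le (D := T ∩ D)
      (fun y hy => ⟨hST y hy, by simpa using hseg y hy 1 ⟨one_pos, le_rfl⟩⟩)
      fun x => ‖φ x - c‖ₑ ^ (p : ℝ)
  calc eLpNorm (fun y => φ y - c) p (μ.restrict (S ∩ D))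
      = eLpNorm ((fun y => φ (y + v) - c) - fun y => φ (y + v) - φ y) p
          (μ.restrict (S ∩ D)) := by
        congr 1; ext y; simp
    _ ≤ eLpNorm (fun y => φ (y + v) - c) p (μ.restrict (S ∩ D)) +
        eLpNorm (fun y => φ (y + v) - φ y) p (μ.restrict (S ∩ D)) :=
        eLpNorm_sub_le (by fun_prop) (by fun_prop) (by exact_mod_cast hp)
    _ ≤ C * eLpNorm (fderiv ℝ φ) p (μ.restrict D) +
        ‖v‖ₑ * eLpNorm (fderiv ℝ φ) p (μ.restrict D) := by
        gcongr
        exact htrans.trans hc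
    _ = _ := by
        rw [ENNReal.coe_add, enorm_eq_nnnorm]
        ring

variable (D) in
/-- The segment condition for a set `D`: near each point of its closure, a fixed vector `v` moves
every point of the closure into `D` along a segment of `D`. At interior points `v = 0` will do. -/
def HasSegmentProperty : Prop :=
  ∀ x ∈ closure D, ∃ v : E, ∃ r > 0, ∀ y ∈ closure D ∩ Metric.ball x r,
    ∀ t ∈ Set.Ioc (0 : ℝ) 1, y + t • v ∈ D

theorem HasSegmentProperty.exists_poincareOn_ball [μ.IsAddHaarMeasure] (hp : 1 ≤ p)
    (hD : HasSegmentProperty D) (hDo : IsOpen D) {x : E} (hx : x ∈ closure D) :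
    ∃ ρ > 0, PoincareOn F μ p D (Metric.ball x ρ) := by
  obtain ⟨v, r, hr, hv⟩ := hD x hx
  have hxv : x + v ∈ D := by
    simpa using hv x ⟨hx, Metric.mem_ball_self hr⟩ 1 ⟨one_pos, le_rfl⟩
  obtain ⟨s, hs, hsD⟩ := Metric.isOpen_iff.1 hDo _ hxv
  refine ⟨min r s, lt_min hr hs, PoincareOn.of_add_mem (v := v) hp
    (poincareOn_of_convex hp (convex_ball (x + v) s) Metric.isOpen_ball (Metric.nonempty_ball.2 hs)
      Metric.isBounded_ball hsD) (fun y hy => ?_) fun y hy => ?_⟩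
  · have hy' := Metric.ball_subset_ball (min_le_right r s) hy.1
    simpa using hy'
  · exact hv y ⟨subset_closure hy.2, Metric.ball_subset_ball (min_le_left r s) hy.1⟩

variable (F μ) in
theorem HasSegmentProperty.exists_eLpNorm_sub_const_le [μ.IsAddHaarMeasure] (hp : 1 ≤ p)
    (hD : HasSegmentProperty D) (hDo : IsOpen D) (hDc : IsConnected D)
    (hDb : Bornology.IsBounded D) :
    ∃ C : ℝ≥0, ∀ φ : E → F, ContDiff ℝ 1 φ → ∃ c : F,
      eLpNorm (fun x => φ x - c) p (μ.restrict D) ≤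
        C * eLpNorm (fderiv ℝ φ) p (μ.restrict D) := by
  obtain ⟨S, -, hDS, hS⟩ : ∃ S, IsOpen S ∧ closure D ⊆ S ∧ PoincareOn F μ p D S := by
    refine exists_isOpen_superset_of_isPreconnected hDb.isCompact_closure
      hDc.isPreconnected.closure hDc.nonempty.closure (fun x hx => ?_) fun S T hS hT hST => ?_
    · obtain ⟨ρ, hρ, hP⟩ := hD.exists_poincareOn_ball (F := F) (μ := μ) hp hDo hx
      exact ⟨_, Metric.isOpen_ball, Metric.mem_ball_self hρ, hP⟩
    · obtain ⟨x, hx, hxST⟩ := hST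
      have hne : (S ∩ T ∩ D).Nonempty := mem_closure_iff.1 hx _ (hS.inter hT) hxST
      exact PoincareOn.union hp
        (measure_ne_top_of_subset (μ := μ) Set.inter_subset_right hDb.measure_lt_top.ne)
        (((hS.inter hT).inter hDo).measure_pos μ hne).ne'
  rwa [PoincareOn, Set.inter_eq_right.2 (subset_closure.trans hDS)] at hS

end Poincare

section Hyperplane

variable {E : Type*} [NormedAddCommGroup E] [InnerProductSpace ℝ E] {ν : E}

theorem orthogonalProjectionOnto_add_smul (y : E) (t : ℝ) :
    (ℝ ∙ ν)ᗮ.orthogonalProjectionOnto (y + t • ν) = (ℝ ∙ ν)ᗮ.orthogonalProjectionOnto y := by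
  have hν : (ℝ ∙ ν)ᗮ.orthogonalProjectionOnto ν = 0 := by
    rw [Submodule.orthogonalProjectionOnto_eq_zero_iff, Submodule.orthogonal_orthogonal]
    exact Submodule.mem_span_singleton_self ν
  rw [map_add, map_smul, hν, smul_zero, add_zero]

theorem orthogonalProjectionOnto_add_inner_smul (hν : ‖ν‖ = 1) (y : E) :
    ((ℝ ∙ ν)ᗮ.orthogonalProjectionOnto y : E) + inner ℝ ν y • ν = y := by
  have h := Submodule.starProjection_add_starProjection_orthogonal (K := ℝ ∙ ν) y
  rwa [Submodule.starProjection_unit_singleton ℝ hν, add_comm] at h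

theorem inner_coe_add_smul (hν : ‖ν‖ = 1) (w : (ℝ ∙ ν)ᗮ) (t : ℝ) :
    inner ℝ ν ((w : E) + t • ν) = t := by
  rw [inner_add_right, inner_smul_right, Submodule.mem_orthogonal_singleton_iff_inner_right.1 w.2,
    real_inner_self_eq_norm_sq, hν]
  simp

/-- Coordinates of a point in the hyperplane orthogonal to a unit vector and along that vector. -/
def hyperplaneCoord (hν : ‖ν‖ = 1) : ((ℝ ∙ ν)ᗮ × ℝ) ≃L[ℝ] E where
  toFun q := q.1 + q.2 • ν
  map_add' q q' := by simp only [Prod.fst_add, Prod.snd_add, Submodule.coe_add, add_smul]; abel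
  map_smul' c q := by simp [smul_smul]
  invFun y := ((ℝ ∙ ν)ᗮ.orthogonalProjectionOnto y, inner ℝ ν y)
  left_inv q := by
    ext1
    · simp [orthogonalProjectionOnto_add_smul]
    · exact inner_coe_add_smul hν q.1 q.2
  right_inv y := orthogonalProjectionOnto_add_inner_smul hν y
  continuous_toFun := by fun_prop
  continuous_invFun := by fun_prop

variable [FiniteDimensional ℝ E] [MeasurableSpace E] [BorelSpace E]

theorem exists_lintegral_lintegral_add_smul_eq (hν : ‖ν‖ = 1) (m : Measure (ℝ ∙ ν)ᗮ)
    [m.IsAddHaarMeasure] (μ : Measure E) [μ.IsAddHaarMeasure] :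
    ∃ c : ℝ≥0, ∀ f : E → ℝ≥0∞, Measurable f →
      ∫⁻ w, (∫⁻ t : ℝ, f (w + t • ν)) ∂m = c * ∫⁻ x, f x ∂μ := by
  set e := hyperplaneCoord hν
  have := e.isAddHaarMeasure_map (m.prod volume)
  obtain ⟨c, hc⟩ : ∃ c : ℝ≥0, (m.prod volume).map e = c • μ :=
    ⟨_, Measure.isAddLeftInvariant_eq_smul ((m.prod volume).map e) μ⟩
  refine ⟨c, fun f hf => ?_⟩
  calc ∫⁻ w, (∫⁻ t : ℝ, f (w + t • ν)) ∂m
      = ∫⁻ x, f x ∂(m.prod volume).map e := by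
        rw [lintegral_map hf e.continuous.measurable, lintegral_prod _ (by fun_prop)]
        rfl
    _ = c * ∫⁻ x, f x ∂μ := by
        rw [hc, lintegral_smul_measure, ENNReal.smul_def, smul_eq_mul]

theorem isAddHaarMeasure_euclideanHausdorffMeasure_orthogonal (hν : ν ≠ 0) :
    (μHE[Module.finrank ℝ E - 1] : Measure (ℝ ∙ ν)ᗮ).IsAddHaarMeasure := by
  have h := Submodule.finrank_add_finrank_orthogonal (ℝ ∙ ν)
  rw [finrank_span_singleton hν] at h
  rw [← h, add_tsub_cancel_left]
  infer_instance

end Hyperplane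

theorem euclideanHausdorffMeasure_image_le {X Y : Type*} [EMetricSpace X] [MeasurableSpace X]
    [BorelSpace X] [EMetricSpace Y] [MeasurableSpace Y] [BorelSpace Y] {L : ℝ≥0} {f : X → Y}
    (hf : LipschitzWith L f) (k : ℕ) (s : Set X) :
    μHE[k] (f '' s) ≤ (L : ℝ≥0∞) ^ k * μHE[k] s := by
  have h := hf.hausdorffMeasure_image_le (Nat.cast_nonneg k) s
  rw [ENNReal.rpow_natCast] at h
  simp only [Measure.euclideanHausdorffMeasure_def, Measure.smul_apply, ENNReal.smul_def,
    smul_eq_mul]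
  rw [mul_left_comm]
  gcongr

section Epigraph

variable {E : Type*} [NormedAddCommGroup E] [InnerProductSpace ℝ E] {D U V : Set E} {ν : E}
  {γ : (ℝ ∙ ν)ᗮ → ℝ} {K : ℝ≥0}

variable (D U ν γ) in
/-- `D` agrees on `U` with the strict epigraph of `γ` over the hyperplane orthogonal to `ν`. -/
def IsEpigraphOn : Prop :=
  ∀ y ∈ U, (y ∈ D ↔ γ ((ℝ ∙ ν)ᗮ.orthogonalProjectionOnto y) < inner ℝ ν y)

variable (ν γ) in
/-- The parametrization of the graph of `γ` by the hyperplane orthogonal to `ν`. -/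
def graphPoint (w : (ℝ ∙ ν)ᗮ) : E := w + γ w • ν

theorem lipschitzWith_graphPoint (hν : ‖ν‖ = 1) (hγ : LipschitzWith K γ) :
    LipschitzWith (1 + K) (graphPoint ν γ) := by
  refine (LipschitzWith.subtype_val _).add (LipschitzWith.of_dist_le_mul fun a b => ?_)
  rw [dist_eq_norm, ← sub_smul, norm_smul, hν, mul_one, ← dist_eq_norm]
  exact hγ.dist_le_mul a b

theorem orthogonalProjectionOnto_graphPoint (w : (ℝ ∙ ν)ᗮ) :
    (ℝ ∙ ν)ᗮ.orthogonalProjectionOnto (graphPoint ν γ w) = w := by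
  simp [graphPoint, orthogonalProjectionOnto_add_smul]

namespace IsEpigraphOn

theorem mono (h : IsEpigraphOn D V ν γ) (hUV : U ⊆ V) : IsEpigraphOn D U ν γ :=
  fun y hy => h y (hUV hy)

theorem le_of_mem_closure (h : IsEpigraphOn D U ν γ) (hU : IsOpen U) (hγ : Continuous γ) {y : E}
    (hy : y ∈ closure D) (hyU : y ∈ U) :
    γ ((ℝ ∙ ν)ᗮ.orthogonalProjectionOnto y) ≤ inner ℝ ν y := by
  have hclosed : IsClosed {y : E | γ ((ℝ ∙ ν)ᗮ.orthogonalProjectionOnto y) ≤ inner ℝ ν y} :=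
    isClosed_le (by fun_prop) (by fun_prop)
  exact closure_minimal (fun z hz => ((h z hz.1).1 hz.2).le) hclosed (hU.inter_closure ⟨hyU, hy⟩)

theorem add_smul_mem (h : IsEpigraphOn D U ν γ) (hU : IsOpen U) (hγ : Continuous γ)
    (hν : ‖ν‖ = 1) {y : E} (hy : y ∈ closure D) (hyU : y ∈ U) {t : ℝ} (ht : 0 < t)
    (hyt : y + t • ν ∈ U) : y + t • ν ∈ D := by
  rw [h _ hyt, orthogonalProjectionOnto_add_smul, inner_add_right, inner_smul_right,
    real_inner_self_eq_norm_sq, hν]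
  linarith [h.le_of_mem_closure hU hγ hy hyU]

theorem graphPoint_orthogonalProjectionOnto (h : IsEpigraphOn D U ν γ) (hU : IsOpen U)
    (hγ : Continuous γ) (hν : ‖ν‖ = 1) (hD : IsOpen D) {y : E} (hy : y ∈ frontier D)
    (hyU : y ∈ U) : graphPoint ν γ ((ℝ ∙ ν)ᗮ.orthogonalProjectionOnto y) = y := by
  rw [hD.frontier_eq] at hy
  have hγy : γ ((ℝ ∙ ν)ᗮ.orthogonalProjectionOnto y) = inner ℝ ν y :=
    le_antisymm (h.le_of_mem_closure hU hγ hy.1 hyU)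
      (not_lt.1 fun hlt => hy.2 ((h y hyU).2 hlt))
  rw [graphPoint, hγy]
  exact orthogonalProjectionOnto_add_inner_smul hν y

theorem graphPoint_mem_frontier (h : IsEpigraphOn D U ν γ) (hU : IsOpen U) (hν : ‖ν‖ = 1)
    (hD : IsOpen D) {w : (ℝ ∙ ν)ᗮ} (hw : graphPoint ν γ w ∈ U) :
    graphPoint ν γ w ∈ frontier D := by
  have hinner : inner ℝ ν (graphPoint ν γ w) = γ w := inner_coe_add_smul hν w (γ w)
  rw [hD.frontier_eq]
  refine ⟨?_, fun hmem => ?_⟩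
  · have hlim : Tendsto (fun t : ℝ => graphPoint ν γ w + t • ν) (𝓝[>] 0)
        (𝓝 (graphPoint ν γ w)) := by
      have hcont : Continuous fun t : ℝ => graphPoint ν γ w + t • ν := by fun_prop
      simpa using (hcont.tendsto 0).mono_left nhdsWithin_le_nhds
    refine mem_closure_of_tendsto hlim ?_
    filter_upwards [hlim (hU.mem_nhds hw), self_mem_nhdsWithin] with t htU ht
    rw [h _ htU, orthogonalProjectionOnto_add_smul, orthogonalProjectionOnto_graphPoint,
      inner_add_right, inner_smul_right, hinner, real_inner_self_eq_norm_sq, hν]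
    simpa using ht
  · have hlt := (h _ hw).1 hmem
    rw [orthogonalProjectionOnto_graphPoint, hinner] at hlt
    exact hlt.false

variable [MeasurableSpace E] [BorelSpace E]

theorem euclideanHausdorffMeasure_restrict_le (h : IsEpigraphOn D U ν γ) (hU : IsOpen U)
    (hγ : LipschitzWith K γ) (hν : ‖ν‖ = 1) (hD : IsOpen D) (k : ℕ) :
    (μHE[k] : Measure E).restrict (U ∩ frontier D) ≤
      ((1 + K) ^ k : ℝ≥0) • (μHE[k] : Measure (ℝ ∙ ν)ᗮ).map (graphPoint ν γ) := by
  have hlip := lipschitzWith_graphPoint hν hγ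
  refine Measure.le_intro fun s hs _ => ?_
  rw [Measure.restrict_apply hs, Measure.smul_apply,
    Measure.map_apply hlip.continuous.measurable hs]
  have hsub : s ∩ (U ∩ frontier D) ⊆ graphPoint ν γ '' (graphPoint ν γ ⁻¹' s) := by
    rintro y ⟨hys, hyU, hyD⟩
    have hy := h.graphPoint_orthogonalProjectionOnto hU hγ.continuous hν hD hyD hyU
    exact ⟨_, by rwa [Set.mem_preimage, hy], hy⟩
  refine (measure_mono hsub).trans ((euclideanHausdorffMeasure_image_le hlip _ _).trans_eq ?_)
  rw [ENNReal.smul_def, smul_eq_mul, ENNReal.coe_pow]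

variable [FiniteDimensional ℝ E]

theorem exists_lintegral_frontier_le (h : IsEpigraphOn D U ν γ) (hU : IsOpen U)
    (hγ : LipschitzWith K γ) (hν : ‖ν‖ = 1) (hD : IsOpen D) (μ : Measure E)
    [μ.IsAddHaarMeasure] :
    ∃ C : ℝ≥0, ∀ f : E → ℝ≥0∞, Measurable f →
      ∫⁻ y in U ∩ frontier D, (∫⁻ t : ℝ, f (y + t • ν)) ∂μHE[Module.finrank ℝ E - 1] ≤
        C * ∫⁻ x, f x ∂μ := by
  have := isAddHaarMeasure_euclideanHausdorffMeasure_orthogonal (norm_ne_zero_iff.1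
    (hν.trans_ne one_ne_zero))
  obtain ⟨c, hc⟩ := exists_lintegral_lintegral_add_smul_eq hν μHE[Module.finrank ℝ E - 1] μ
  refine ⟨(1 + K) ^ (Module.finrank ℝ E - 1) * c, fun f hf => ?_⟩
  refine (lintegral_mono'
    (h.euclideanHausdorffMeasure_restrict_le hU hγ hν hD _) le_rfl).trans ?_
  rw [lintegral_smul_measure, ENNReal.smul_def, smul_eq_mul, ENNReal.coe_mul, mul_assoc, ← hc f hf]
  gcongr
  refine (lintegral_map_le _ _).trans_eq (lintegral_congr fun w => ?_)
  rw [← lintegral_add_left_eq_self (fun t : ℝ => f (w + t • ν)) (γ w)]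
  simp only [graphPoint, add_smul, add_assoc]

end IsEpigraphOn

end Epigraph

theorem add_smul_mem_ball {E : Type*} [NormedAddCommGroup E] [NormedSpace ℝ E] {x y ν : E}
    (hν : ‖ν‖ = 1) {r t : ℝ} (hy : y ∈ Metric.ball x (r / 2)) (ht : 0 ≤ t) (htr : t ≤ r / 2) :
    y + t • ν ∈ Metric.ball x r := by
  have hnorm : ‖t • ν‖ = t := by rw [norm_smul, Real.norm_of_nonneg ht, hν, mul_one]
  rw [mem_ball_iff_norm] at hy ⊢
  calc ‖y + t • ν - x‖ = ‖(y - x) + t • ν‖ := by congr 1; abel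
    _ ≤ ‖y - x‖ + ‖t • ν‖ := norm_add_le _ _
    _ < r := by linarith

theorem IsEpigraphOn.exists_setLIntegral_segment_le {E : Type*} [NormedAddCommGroup E]
    [InnerProductSpace ℝ E] [FiniteDimensional ℝ E] [MeasurableSpace E] [BorelSpace E]
    {D : Set E} {x ν : E} {r : ℝ} {γ : (ℝ ∙ ν)ᗮ → ℝ} {K : ℝ≥0}
    (h : IsEpigraphOn D (Metric.ball x r) ν γ) (hγ : LipschitzWith K γ) (hν : ‖ν‖ = 1)
    (hr : 0 < r) (hD : IsOpen D) (μ : Measure E) [μ.IsAddHaarMeasure] :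
    ∃ C : ℝ≥0, ∀ f : E → ℝ≥0∞, Measurable f →
      ∫⁻ y in Metric.ball x (r / 2) ∩ frontier D,
          (∫⁻ t in Set.Ioo 0 (r / 2), f (y + t • ν)) ∂μHE[Module.finrank ℝ E - 1] ≤
        C * ∫⁻ x in D, f x ∂μ := by
  have hsub : Metric.ball x (r / 2) ⊆ Metric.ball x r := Metric.ball_subset_ball (by linarith)
  obtain ⟨C, hC⟩ := (h.mono hsub).exists_lintegral_frontier_le Metric.isOpen_ball hγ hν hD μ
  refine ⟨C, fun f hf => ?_⟩
  rw [← lintegral_indicator hD.measurableSet]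
  refine le_trans ?_ (hC _ (hf.indicator hD.measurableSet))
  refine setLIntegral_mono' (measurableSet_ball.inter isClosed_frontier.measurableSet)
    fun y hy => ?_
  rw [← lintegral_indicator measurableSet_Ioo]
  refine lintegral_mono fun t => Set.indicator_apply_le' (fun ht => ?_) fun _ => zero_le
  rw [Set.indicator_of_mem (h.add_smul_mem Metric.isOpen_ball hγ.continuous hν
    (frontier_subset_closure hy.2) (hsub hy.1) ht.1 (add_smul_mem_ball hν hy.1 ht.1.le ht.2.le))]

section Trace

variable {E F : Type*} [NormedAddCommGroup E] [NormedSpace ℝ E] [NormedAddCommGroup F]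
  [NormedSpace ℝ F] [CompleteSpace F] {φ : E → F}

theorem ofReal_mul_enorm_rpow_le_setLIntegral_segment (hφ : ContDiff ℝ 1 φ) (y v : E) (τ : ℝ)
    {p : ℝ} (hp : 1 ≤ p) :
    ENNReal.ofReal τ * ‖φ y‖ₑ ^ p ≤ 2 ^ (p - 1) *
      ((∫⁻ t in Set.Ioo 0 τ, ‖φ (y + t • v)‖ₑ ^ p) + ‖v‖ₑ ^ p * ENNReal.ofReal τ ^ p *
        ∫⁻ t in Set.Ioo 0 τ, ‖fderiv ℝ φ (y + t • v)‖ₑ ^ p) := by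
  set I := ∫⁻ t in Set.Ioo 0 τ, ‖fderiv ℝ φ (y + t • v)‖ₑ ^ p
  have hφm : Measurable fun t : ℝ => ‖φ (y + t • v)‖ₑ ^ p := by
    have hcont : Continuous fun t : ℝ => φ (y + t • v) := hφ.continuous.comp (by fun_prop)
    exact hcont.enorm.measurable.pow_const p
  have hpoint : ∀ t ∈ Set.Ioo 0 τ, ‖φ y‖ₑ ^ p ≤ 2 ^ (p - 1) *
      (‖φ (y + t • v)‖ₑ ^ p + ‖v‖ₑ ^ p * ENNReal.ofReal τ ^ (p - 1) * I) := fun t ht =>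
    calc ‖φ y‖ₑ ^ p
        ≤ (‖φ (y + t • v)‖ₑ + ‖φ (y + t • v) - φ y‖ₑ) ^ p := by
          gcongr
          simpa using enorm_sub_le (a := φ (y + t • v)) (b := φ (y + t • v) - φ y)
      _ ≤ 2 ^ (p - 1) * (‖φ (y + t • v)‖ₑ ^ p + ‖φ (y + t • v) - φ y‖ₑ ^ p) :=
          ENNReal.rpow_add_le_mul_rpow_add_rpow _ _ hp
      _ ≤ _ := by
          gcongr
          refine (enorm_add_smul_sub_rpow_le hφ y v ht.1.le hp).trans ?_
          gcongr
          · exact ht.2.le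
          · exact lintegral_mono_set (Set.Ioo_subset_Ioo_right ht.2.le)
  have hτ : ENNReal.ofReal τ ^ (p - 1) * ENNReal.ofReal τ = ENNReal.ofReal τ ^ p := by
    simpa using (ENNReal.rpow_add_of_nonneg (x := ENNReal.ofReal τ) (p - 1) 1
      (sub_nonneg.2 hp) zero_le_one).symm
  calc ENNReal.ofReal τ * ‖φ y‖ₑ ^ p
      = ∫⁻ _ in Set.Ioo 0 τ, ‖φ y‖ₑ ^ p := by
        rw [setLIntegral_const, Real.volume_Ioo, sub_zero, mul_comm]
    _ ≤ ∫⁻ t in Set.Ioo 0 τ, 2 ^ (p - 1) *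
          (‖φ (y + t • v)‖ₑ ^ p + ‖v‖ₑ ^ p * ENNReal.ofReal τ ^ (p - 1) * I) :=
        setLIntegral_mono' measurableSet_Ioo hpoint
    _ = _ := by
        rw [lintegral_const_mul _ (hφm.add_const _), lintegral_add_left hφm, setLIntegral_const,
          Real.volume_Ioo, sub_zero, ← hτ]
        ring

variable [MeasurableSpace E] [BorelSpace E] [SecondCountableTopology E] {p : ℝ≥0}
  {σ κ : Measure E} {C : ℝ≥0} {v : E} {τ : ℝ}

theorem ofReal_mul_lintegral_rpow_le_of_segment (hφ : ContDiff ℝ 1 φ) {p : ℝ} (hp : 1 ≤ p)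
    (hσ : ∀ f : E → ℝ≥0∞, Measurable f →
      ∫⁻ y, (∫⁻ t in Set.Ioo 0 τ, f (y + t • v)) ∂σ ≤ C * ∫⁻ x, f x ∂κ) :
    ENNReal.ofReal τ * ∫⁻ y, ‖φ y‖ₑ ^ p ∂σ ≤ 2 ^ (p - 1) * C *
      ((∫⁻ x, ‖φ x‖ₑ ^ p ∂κ) +
        ‖v‖ₑ ^ p * ENNReal.ofReal τ ^ p * ∫⁻ x, ‖fderiv ℝ φ x‖ₑ ^ p ∂κ) := by
  have hφm : Measurable fun x => ‖φ x‖ₑ ^ p := hφ.continuous.enorm.measurable.pow_const p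
  have hdm : Measurable fun x => ‖fderiv ℝ φ x‖ₑ ^ p :=
    (hφ.continuous_fderiv (by simp)).enorm.measurable.pow_const p
  have hsegm {f : E → ℝ≥0∞} (hf : Measurable f) :
      Measurable fun y => ∫⁻ t in Set.Ioo 0 τ, f (y + t • v) :=
    Measurable.lintegral_prod_right' (f := fun q : E × ℝ => f (q.1 + q.2 • v))
      (hf.comp (by fun_prop))
  calc ENNReal.ofReal τ * ∫⁻ y, ‖φ y‖ₑ ^ p ∂σ
      = ∫⁻ y, ENNReal.ofReal τ * ‖φ y‖ₑ ^ p ∂σ := (lintegral_const_mul _ hφm).symm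
    _ ≤ ∫⁻ y, 2 ^ (p - 1) * ((∫⁻ t in Set.Ioo 0 τ, ‖φ (y + t • v)‖ₑ ^ p) +
          ‖v‖ₑ ^ p * ENNReal.ofReal τ ^ p *
            ∫⁻ t in Set.Ioo 0 τ, ‖fderiv ℝ φ (y + t • v)‖ₑ ^ p) ∂σ :=
        lintegral_mono fun y => ofReal_mul_enorm_rpow_le_setLIntegral_segment hφ y v τ hp
    _ ≤ 2 ^ (p - 1) * (C * (∫⁻ x, ‖φ x‖ₑ ^ p ∂κ) +
          ‖v‖ₑ ^ p * ENNReal.ofReal τ ^ p * (C * ∫⁻ x, ‖fderiv ℝ φ x‖ₑ ^ p ∂κ)) := by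
        rw [lintegral_const_mul' _ _ (ENNReal.rpow_ne_top_of_nonneg (sub_nonneg.2 hp)
            ENNReal.ofNat_ne_top),
          lintegral_add_left (hsegm hφm), lintegral_const_mul _ (hsegm hdm)]
        gcongr
        · exact hσ _ hφm
        · exact hσ _ hdm
    _ = _ := by ring

theorem exists_eLpNorm_le_of_segment (hp : 1 ≤ p) (hτ : 0 < τ)
    (hσ : ∀ f : E → ℝ≥0∞, Measurable f →
      ∫⁻ y, (∫⁻ t in Set.Ioo 0 τ, f (y + t • v)) ∂σ ≤ C * ∫⁻ x, f x ∂κ) :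
    ∃ C' : ℝ≥0, ∀ φ : E → F, ContDiff ℝ 1 φ →
      eLpNorm φ p σ ≤ C' * (eLpNorm φ p κ + eLpNorm (fderiv ℝ φ) p κ) := by
  have hp₀ : p ≠ 0 := (zero_lt_one.trans_le hp).ne'
  have hp₁ : (1 : ℝ) ≤ p := by exact_mod_cast hp
  have hτ₀ : ENNReal.ofReal τ ≠ 0 := by simpa using hτ
  set K : ℝ≥0∞ :=
    2 ^ ((p : ℝ) - 1) * C * (1 + ‖v‖ₑ ^ (p : ℝ) * ENNReal.ofReal τ ^ (p : ℝ)) / ENNReal.ofReal τ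
  have hK : K ≠ ⊤ := by
    refine ENNReal.div_ne_top (ENNReal.mul_ne_top (ENNReal.mul_ne_top
      (ENNReal.rpow_ne_top_of_nonneg (sub_nonneg.2 hp₁) ENNReal.ofNat_ne_top) ENNReal.coe_ne_top)
      (ENNReal.add_ne_top.2 ⟨ENNReal.one_ne_top, ENNReal.mul_ne_top ?_ ?_⟩)) hτ₀
    · exact ENNReal.rpow_ne_top_of_nonneg p.coe_nonneg enorm_ne_top
    · exact ENNReal.rpow_ne_top_of_nonneg p.coe_nonneg ENNReal.ofReal_ne_top
  refine ⟨(K ^ (1 / (p : ℝ))).toNNReal, fun φ hφ => eLpNorm_le_of_lintegral_rpow_le hp₀ ?_⟩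
  rw [ENNReal.coe_toNNReal (ENNReal.rpow_ne_top_of_nonneg (by positivity) hK),
    ENNReal.mul_rpow_of_nonneg _ _ p.coe_nonneg, ← ENNReal.rpow_mul,
    one_div_mul_cancel (by exact_mod_cast hp₀), ENNReal.rpow_one]
  calc ∫⁻ y, ‖φ y‖ₑ ^ (p : ℝ) ∂σ
      ≤ 2 ^ ((p : ℝ) - 1) * C * ((∫⁻ x, ‖φ x‖ₑ ^ (p : ℝ) ∂κ) +
          ‖v‖ₑ ^ (p : ℝ) * ENNReal.ofReal τ ^ (p : ℝ) * ∫⁻ x, ‖fderiv ℝ φ x‖ₑ ^ (p : ℝ) ∂κ) /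
            ENNReal.ofReal τ := by
        rw [ENNReal.le_div_iff_mul_le (Or.inl hτ₀) (Or.inl ENNReal.ofReal_ne_top), mul_comm]
        exact ofReal_mul_lintegral_rpow_le_of_segment hφ hp₁ hσ
    _ ≤ 2 ^ ((p : ℝ) - 1) * C * ((1 + ‖v‖ₑ ^ (p : ℝ) * ENNReal.ofReal τ ^ (p : ℝ)) *
          ((∫⁻ x, ‖φ x‖ₑ ^ (p : ℝ) ∂κ) + ∫⁻ x, ‖fderiv ℝ φ x‖ₑ ^ (p : ℝ) ∂κ)) /
            ENNReal.ofReal τ := by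
        gcongr
        rw [add_mul, one_mul, mul_add]
        exact add_le_add le_self_add le_add_self |>.trans (by gcongr)
    _ = K * ((∫⁻ x, ‖φ x‖ₑ ^ (p : ℝ) ∂κ) + ∫⁻ x, ‖fderiv ℝ φ x‖ₑ ^ (p : ℝ) ∂κ) := by
        rw [← mul_assoc, ENNReal.mul_div_right_comm]
    _ ≤ _ := by
        gcongr
        rw [← eLpNorm_nnreal_pow_eq_lintegral hp₀, ← eLpNorm_nnreal_pow_eq_lintegral hp₀]
        exact ENNReal.add_rpow_le_rpow_add _ _ hp₁

end Trace

theorem frontier_nonempty_of_isBounded {E : Type*} [NormedAddCommGroup E] [NormedSpace ℝ E]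
    [Nontrivial E] {D : Set E} (hD : D.Nonempty) (hDb : Bornology.IsBounded D) :
    (frontier D).Nonempty :=
  nonempty_frontier_iff.2
    ⟨hD, fun h => NormedSpace.unbounded_univ ℝ E (h ▸ hDb)⟩

theorem IsEpigraphOn.euclideanHausdorffMeasure_frontier_pos {E : Type*} [NormedAddCommGroup E]
    [InnerProductSpace ℝ E] [FiniteDimensional ℝ E] [MeasurableSpace E] [BorelSpace E]
    {D U : Set E} {x ν : E} {γ : (ℝ ∙ ν)ᗮ → ℝ} {K : ℝ≥0} (h : IsEpigraphOn D U ν γ)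
    (hU : IsOpen U) (hγ : LipschitzWith K γ) (hν : ‖ν‖ = 1) (hD : IsOpen D)
    (hx : x ∈ frontier D) (hxU : x ∈ U) : 0 < μHE[Module.finrank ℝ E - 1] (frontier D) := by
  have := isAddHaarMeasure_euclideanHausdorffMeasure_orthogonal (norm_ne_zero_iff.1
    (hν.trans_ne one_ne_zero))
  set P := (ℝ ∙ ν)ᗮ.orthogonalProjectionOnto
  have hopen : IsOpen (graphPoint ν γ ⁻¹' U) :=
    hU.preimage (lipschitzWith_graphPoint hν hγ).continuous
  have hmem : P x ∈ graphPoint ν γ ⁻¹' U := by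
    rwa [Set.mem_preimage, h.graphPoint_orthogonalProjectionOnto hU hγ.continuous hν hD hx hxU]
  have hsub : graphPoint ν γ ⁻¹' U ⊆ P '' frontier D := fun w hw =>
    ⟨_, h.graphPoint_mem_frontier hU hν hD hw, orthogonalProjectionOnto_graphPoint w⟩
  have hP := euclideanHausdorffMeasure_image_le
    (ℝ ∙ ν)ᗮ.lipschitzWith_orthogonalProjectionOnto (Module.finrank ℝ E - 1) (frontier D)
  rw [ENNReal.coe_one, one_pow, one_mul] at hP
  exact (hopen.measure_pos μHE[Module.finrank ℝ E - 1] ⟨_, hmem⟩).trans_le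
    ((measure_mono hsub).trans hP)

theorem memLp_of_continuous {X F : Type*} [TopologicalSpace X] [MeasurableSpace X]
    [OpensMeasurableSpace X] {μ : Measure X} [IsFiniteMeasure μ] [NormedAddCommGroup F]
    [SecondCountableTopologyEither X F] {f : X → F} (hf : Continuous f) {K : Set X}
    (hK : IsCompact K) (hμ : ∀ᵐ x ∂μ, x ∈ K) (p : ℝ≥0∞) : MemLp f p μ := by
  obtain ⟨C, hC⟩ := hK.exists_bound_of_continuousOn hf.continuousOn
  exact MemLp.of_bound hf.aestronglyMeasurable C (hμ.mono hC)

namespace IsLipschitzDomain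

variable {d : ℕ} {D : Set (EuclideanSpace ℝ (Fin d))} {F : Type*} [NormedAddCommGroup F]

theorem hasSegmentProperty (hD : IsLipschitzDomain D) : HasSegmentProperty D := by
  intro x hx
  by_cases hxD : x ∈ D
  · obtain ⟨r, hr, hrD⟩ := Metric.isOpen_iff.1 hD.isOpen x hxD
    exact ⟨0, r, hr, fun y hy t _ => by simpa using hrD hy.2⟩
  · obtain ⟨ν, hν, K, γ, hγ, r, hr, (h : IsEpigraphOn D (Metric.ball x r) ν γ)⟩ :=
      hD.local_epigraph x (by rw [hD.isOpen.frontier_eq]; exact ⟨hx, hxD⟩)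
    refine ⟨(r / 2) • ν, r / 2, half_pos hr, fun y hy t ht => ?_⟩
    have hpos : 0 < t * (r / 2) := mul_pos ht.1 (half_pos hr)
    rw [smul_smul]
    exact h.add_smul_mem Metric.isOpen_ball hγ.continuous hν hy.1
      (Metric.ball_subset_ball (by linarith) hy.2) hpos
      (add_smul_mem_ball hν hy.2 hpos.le (mul_le_of_le_one_left (half_pos hr).le ht.2))

section Trace

variable (F) [NormedSpace ℝ F] [CompleteSpace F] {p : ℝ≥0}

theorem exists_eLpNorm_trace_ball_le (hp : 1 ≤ p) (hD : IsLipschitzDomain D)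
    {x : EuclideanSpace ℝ (Fin d)} (hx : x ∈ frontier D) :
    ∃ ρ > 0, ∃ C : ℝ≥0, ∀ φ : EuclideanSpace ℝ (Fin d) → F, ContDiff ℝ 1 φ →
      eLpNorm φ p ((surf D).restrict (Metric.ball x ρ)) ≤
        C * (eLpNorm φ p (bulk D) + eLpNorm (fderiv ℝ φ) p (bulk D)) := by
  obtain ⟨ν, hν, K, γ, hγ, r, hr, (h : IsEpigraphOn D (Metric.ball x r) ν γ)⟩ :=
    hD.local_epigraph x hx
  obtain ⟨C, hC⟩ := h.exists_setLIntegral_segment_le hγ hν hr hD.isOpen volume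
  rw [finrank_euclideanSpace_fin, ← Measure.restrict_restrict measurableSet_ball] at hC
  exact ⟨r / 2, half_pos hr, exists_eLpNorm_le_of_segment hp (half_pos hr) hC⟩

theorem exists_eLpNorm_trace_le (hp : 1 ≤ p) (hD : IsLipschitzDomain D) :
    ∃ C : ℝ≥0, ∀ φ : EuclideanSpace ℝ (Fin d) → F, ContDiff ℝ 1 φ →
      eLpNorm φ p (surf D) ≤
        C * (eLpNorm φ p (bulk D) + eLpNorm (fderiv ℝ φ) p (bulk D)) := by
  have hcompact : IsCompact (frontier D) :=
    hD.isBounded.isCompact_closure.of_isClosed_subset isClosed_frontier frontier_subset_closure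
  have h : ∃ C : ℝ≥0, ∀ φ : EuclideanSpace ℝ (Fin d) → F, ContDiff ℝ 1 φ →
      eLpNorm φ p ((surf D).restrict (frontier D)) ≤
        C * (eLpNorm φ p (bulk D) + eLpNorm (fderiv ℝ φ) p (bulk D)) := by
    refine hcompact.induction_on
      (p := fun S => ∃ C : ℝ≥0, ∀ φ : EuclideanSpace ℝ (Fin d) → F, ContDiff ℝ 1 φ →
        eLpNorm φ p ((surf D).restrict S) ≤
          C * (eLpNorm φ p (bulk D) + eLpNorm (fderiv ℝ φ) p (bulk D))) ?_ ?_ ?_ ?_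
    · exact ⟨0, fun φ _ => by simp⟩
    · rintro S T hST ⟨C, hC⟩
      exact ⟨C, fun φ hφ =>
        (eLpNorm_mono_measure φ (Measure.restrict_mono hST le_rfl)).trans (hC φ hφ)⟩
    · rintro S T ⟨C, hC⟩ ⟨C', hC'⟩
      refine ⟨C + C', fun φ hφ => (eLpNorm_restrict_union_le hp _ φ S T).trans ?_⟩
      rw [ENNReal.coe_add, add_mul]
      exact add_le_add (hC φ hφ) (hC' φ hφ)
    · intro x hx
      obtain ⟨ρ, hρ, hC⟩ := hD.exists_eLpNorm_trace_ball_le F hp hx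
      exact ⟨_, mem_nhdsWithin_of_mem_nhds (Metric.ball_mem_nhds x hρ), hC⟩
  simpa [Measure.restrict_restrict isClosed_frontier.measurableSet] using h

end Trace

theorem isFiniteMeasure_bulk (hD : IsLipschitzDomain D) : IsFiniteMeasure (bulk D) :=
  isFiniteMeasure_restrict.2 hD.isBounded.measure_lt_top.ne

theorem isFiniteMeasure_surf (hD : IsLipschitzDomain D) : IsFiniteMeasure (surf D) := by
  obtain ⟨C, hC⟩ := hD.exists_eLpNorm_trace_le ℝ le_rfl
  have h := hC (fun _ => 1) contDiff_const
  have := hD.isFiniteMeasure_bulk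
  have hle : surf D Set.univ ≤ C * bulk D Set.univ := by
    simpa [eLpNorm_one_eq_lintegral_enorm, enorm_eq_nnnorm] using h
  exact ⟨hle.trans_lt (ENNReal.mul_lt_top ENNReal.coe_lt_top (measure_lt_top _ _))⟩

theorem surf_univ_pos (hd : 1 ≤ d) (hD : IsLipschitzDomain D) : 0 < surf D Set.univ := by
  have : Nonempty (Fin d) := ⟨⟨0, hd⟩⟩
  obtain ⟨x, hx⟩ := frontier_nonempty_of_isBounded hD.isConnected.nonempty hD.isBounded
  obtain ⟨ν, hν, K, γ, hγ, r, hr, (h : IsEpigraphOn D (Metric.ball x r) ν γ)⟩ :=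
    hD.local_epigraph x hx
  have hpos := h.euclideanHausdorffMeasure_frontier_pos Metric.isOpen_ball hγ hν hD.isOpen hx
    (Metric.mem_ball_self hr)
  rwa [finrank_euclideanSpace_fin, ← Measure.restrict_apply_univ] at hpos

theorem memLp_bulk (hD : IsLipschitzDomain D) {f : EuclideanSpace ℝ (Fin d) → F}
    (hf : Continuous f) (p : ℝ≥0∞) : MemLp f p (bulk D) := by
  have := hD.isFiniteMeasure_bulk
  exact memLp_of_continuous hf hD.isBounded.isCompact_closure
    ((ae_restrict_mem hD.isOpen.measurableSet).mono fun _ hx => subset_closure hx) p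

theorem memLp_surf (hD : IsLipschitzDomain D) {f : EuclideanSpace ℝ (Fin d) → F}
    (hf : Continuous f) (p : ℝ≥0∞) : MemLp f p (surf D) := by
  have := hD.isFiniteMeasure_surf
  exact memLp_of_continuous hf hD.isBounded.isCompact_closure
    ((ae_restrict_mem isClosed_frontier.measurableSet).mono
      fun _ hx => frontier_subset_closure hx) p

end IsLipschitzDomain

theorem exists_norm_le_of_norm_sub_smul_le {𝕜 X Y : Type*} [NontriviallyNormedField 𝕜]
    [NormedAddCommGroup X] [NormedSpace 𝕜 X] [NormedAddCommGroup Y] [NormedSpace 𝕜 Y]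
    (T : X →L[𝕜] Y) (m : X →L[𝕜] 𝕜) {e : X} (he : m e ≠ 0) {S : Set X} {C : ℝ}
    (hC : ∀ z ∈ S, ∃ c : 𝕜, ‖z - c • e‖ ≤ C * ‖T z‖) :
    ∃ C' > 0, ∀ z ∈ closure S, m z = 0 → ‖z‖ ≤ C' * ‖T z‖ := by
  -- `P` is the projection onto `ker m` along `e`, so `P z = P (z - c • e)`.
  let P : X →L[𝕜] X := ContinuousLinearMap.id 𝕜 X - ((m e)⁻¹ • m).smulRight e
  have hP (z : X) : P z = z - ((m e)⁻¹ * m z) • e := rfl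
  have hPe : P e = 0 := by rw [hP, inv_mul_cancel₀ he, one_smul, sub_self]
  have hS : ∀ z ∈ S, ‖P z‖ ≤ ‖P‖ * C * ‖T z‖ := by
    intro z hz
    obtain ⟨c, hc⟩ := hC z hz
    calc ‖P z‖ = ‖P (z - c • e)‖ := by rw [map_sub, map_smul, hPe, smul_zero, sub_zero]
      _ ≤ ‖P‖ * ‖z - c • e‖ := P.le_opNorm _
      _ ≤ ‖P‖ * (C * ‖T z‖) := by gcongr
      _ = ‖P‖ * C * ‖T z‖ := (mul_assoc _ _ _).symm
  have hcl : IsClosed {z | ‖P z‖ ≤ ‖P‖ * C * ‖T z‖} := isClosed_le (by fun_prop) (by fun_prop)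
  refine ⟨max (‖P‖ * C) 1, by positivity, fun z hz hmz => ?_⟩
  calc ‖z‖ = ‖P z‖ := by rw [hP, hmz, mul_zero, zero_smul, sub_zero]
    _ ≤ ‖P‖ * C * ‖T z‖ := hcl.closure_subset_iff.2 hS hz
    _ ≤ max (‖P‖ * C) 1 * ‖T z‖ := by gcongr; exact le_max_left _ _

section LaxMilgram

variable {X : Type*} [NormedAddCommGroup X] [InnerProductSpace ℝ X] [CompleteSpace X]
  {b : X →L[ℝ] X →L[ℝ] ℝ} {c : ℝ}

theorem exists_mem_forall_eq_of_coercive {S : Submodule ℝ X} (hS : IsClosed (S : Set X))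
    (hc : 0 < c) (hb : ∀ u ∈ S, c * ‖u‖ * ‖u‖ ≤ b u u) (ℓ : X →L[ℝ] ℝ) :
    ∃ u ∈ S, ∀ v ∈ S, b u v = ℓ v := by
  have : CompleteSpace S := hS.completeSpace_coe
  have hB : IsCoercive (b.bilinearComp S.subtypeL S.subtypeL) := ⟨c, hc, fun u => hb u u.2⟩
  have hu := fun v => hB.continuousLinearEquivOfBilin_apply
    (hB.continuousLinearEquivOfBilin.symm
      ((InnerProductSpace.toDual ℝ S).symm (ℓ.comp S.subtypeL))) v
  simp only [ContinuousLinearEquiv.apply_symm_apply, InnerProductSpace.toDual_symm_apply] at hu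
  exact ⟨_, Subtype.property _, fun v hv => (hu ⟨v, hv⟩).symm⟩

theorem exists_mem_ker_forall_eq_of_coercive {S : Submodule ℝ X} (hS : IsClosed (S : Set X))
    {m ℓ : X →L[ℝ] ℝ} (hc : 0 < c) (hb : ∀ u ∈ S, m u = 0 → c * ‖u‖ * ‖u‖ ≤ b u u)
    {e : X} (heS : e ∈ S) (hme : m e ≠ 0) (hbe : ∀ u, b u e = 0) (hℓe : ℓ e = 0) :
    ∃ u ∈ S, m u = 0 ∧ ∀ v ∈ S, b u v = ℓ v := by
  obtain ⟨u, hu, huv⟩ := exists_mem_forall_eq_of_coercive (S := S ⊓ m.ker)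
    (hS.inter m.isClosed_ker) hc (fun u hu => hb u hu.1 hu.2) ℓ
  refine ⟨u, hu.1, hu.2, fun v hv => ?_⟩
  have hmem : v - (m v / m e) • e ∈ S ⊓ m.ker :=
    ⟨S.sub_mem hv (S.smul_mem _ heS), by simp [hme]⟩
  simpa [hbe, hℓe] using huv _ hmem

end LaxMilgram

section Bilin

variable {d : ℕ}

theorem bilin_eq_sum (M : Matrix (Fin d) (Fin d) ℝ) (ξ η : EuclideanSpace ℝ (Fin d)) :
    bilin M ξ η = ∑ i, ξ i * ∑ j, M i j * η j := rfl

theorem bilin_add_left (M : Matrix (Fin d) (Fin d) ℝ) (ξ ξ' η : EuclideanSpace ℝ (Fin d)) :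
    bilin M (ξ + ξ') η = bilin M ξ η + bilin M ξ' η := by
  simp [bilin, add_dotProduct]

theorem bilin_add_right (M : Matrix (Fin d) (Fin d) ℝ) (ξ η η' : EuclideanSpace ℝ (Fin d)) :
    bilin M ξ (η + η') = bilin M ξ η + bilin M ξ η' := by
  simp [bilin, Matrix.mulVec_add, dotProduct_add]

theorem bilin_smul_left (M : Matrix (Fin d) (Fin d) ℝ) (c : ℝ)
    (ξ η : EuclideanSpace ℝ (Fin d)) : bilin M (c • ξ) η = c * bilin M ξ η := by
  simp [bilin, smul_dotProduct]

theorem bilin_smul_right (M : Matrix (Fin d) (Fin d) ℝ) (c : ℝ)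
    (ξ η : EuclideanSpace ℝ (Fin d)) : bilin M ξ (c • η) = c * bilin M ξ η := by
  simp [bilin, Matrix.mulVec_smul, dotProduct_smul]

theorem bilin_sub_matrix (M N : Matrix (Fin d) (Fin d) ℝ) (ξ η : EuclideanSpace ℝ (Fin d)) :
    bilin (M - N) ξ η = bilin M ξ η - bilin N ξ η := by
  simp [bilin, Matrix.sub_mulVec, dotProduct_sub]

theorem bilin_comm {M : Matrix (Fin d) (Fin d) ℝ} (hM : M.IsSymm)
    (ξ η : EuclideanSpace ℝ (Fin d)) : bilin M ξ η = bilin M η ξ := by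
  rw [bilin, Matrix.dotProduct_mulVec, ← Matrix.mulVec_transpose, hM.eq, dotProduct_comm]
  rfl

theorem continuous_bilin (ξ η : EuclideanSpace ℝ (Fin d)) :
    Continuous fun M : Matrix (Fin d) (Fin d) ℝ => bilin M ξ η :=
  continuous_const.dotProduct (continuous_id.matrix_mulVec continuous_const)

theorem abs_bilin_le_sum (M : Matrix (Fin d) (Fin d) ℝ) (ξ η : EuclideanSpace ℝ (Fin d)) :
    |bilin M ξ η| ≤ (∑ i, ∑ j, |M i j|) * ‖ξ‖ * ‖η‖ := by
  rw [bilin_eq_sum]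
  simp only [Finset.sum_mul]
  refine (Finset.abs_sum_le_sum_abs _ _).trans (Finset.sum_le_sum fun i _ => ?_)
  rw [Finset.mul_sum]
  refine (Finset.abs_sum_le_sum_abs _ _).trans (Finset.sum_le_sum fun j _ => ?_)
  have hξ : |ξ i| ≤ ‖ξ‖ := PiLp.norm_apply_le ξ i
  have hη : |η j| ≤ ‖η‖ := PiLp.norm_apply_le η j
  calc |ξ i * (M i j * η j)| = |M i j| * |ξ i| * |η j| := by rw [abs_mul, abs_mul]; ring
    _ ≤ |M i j| * ‖ξ‖ * ‖η‖ := by gcongr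

theorem isClosed_coeffSet (d : ℕ) (α β : ℝ) : IsClosed (coeffSet d α β) := by
  have hsymm : IsClosed {M : Matrix (Fin d) (Fin d) ℝ | M.IsSymm} :=
    isClosed_eq continuous_id.matrix_transpose continuous_id
  have hcoercive : IsClosed {M : Matrix (Fin d) (Fin d) ℝ |
      ∀ ξ : EuclideanSpace ℝ (Fin d), α * ‖ξ‖ ^ 2 ≤ bilin M ξ ξ} := by
    simp only [Set.ofPred_forall]
    exact isClosed_iInter fun ξ => isClosed_le continuous_const (continuous_bilin ξ ξ)
  have hbounded : IsClosed {M : Matrix (Fin d) (Fin d) ℝ |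
      ∀ ξ η : EuclideanSpace ℝ (Fin d), |bilin M ξ η| ≤ β * ‖ξ‖ * ‖η‖} := by
    simp only [Set.ofPred_forall]
    exact isClosed_iInter fun ξ => isClosed_iInter fun η =>
      isClosed_le (continuous_bilin ξ η).abs continuous_const
  exact hsymm.inter (hcoercive.inter hbounded)

theorem abs_apply_le_of_mem_coeffSet {α β : ℝ} {M : Matrix (Fin d) (Fin d) ℝ}
    (hM : M ∈ coeffSet d α β) (i j : Fin d) : |M i j| ≤ β := by
  simpa [bilin_eq_sum] using hM.2.2 (EuclideanSpace.single i 1) (EuclideanSpace.single j 1)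

theorem isCompact_coeffSet (d : ℕ) (α β : ℝ) : IsCompact (coeffSet d α β) := by
  have hK : IsCompact (Set.univ.pi fun _ : Fin d => Set.univ.pi fun _ : Fin d => Set.Icc (-β) β) :=
    isCompact_univ_pi fun _ => isCompact_univ_pi fun _ => isCompact_Icc
  exact hK.of_isClosed_subset (isClosed_coeffSet d α β) fun M hM i _ j _ =>
    abs_le.1 (abs_apply_le_of_mem_coeffSet hM i j)

end Bilin

theorem integral_norm_mul_norm_le {X F G : Type*} [MeasurableSpace X] {μ : Measure X}
    [NormedAddCommGroup F] [NormedAddCommGroup G] (f : Lp F 2 μ) (g : Lp G 2 μ) :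
    ∫ x, ‖f x‖ * ‖g x‖ ∂μ ≤ ‖f‖ * ‖g‖ := by
  have hf := (Lp.memLp f).norm
  have hg := (Lp.memLp g).norm
  have h : ∫ x, ‖f x‖ * ‖g x‖ ∂μ = inner ℝ (hf.toLp _) (hg.toLp _) := by
    rw [L2.inner_def]
    refine integral_congr_ae ?_
    filter_upwards [hf.coeFn_toLp, hg.coeFn_toLp] with x hfx hgx
    simp [hfx, hgx, mul_comm]
  simpa [h, Lp.norm_toLp, eLpNorm_norm, ← Lp.norm_def] using
    real_inner_le_norm (hf.toLp _) (hg.toLp _)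

section Form

variable {X : Type*} [MeasurableSpace X] {μ : Measure X} {d : ℕ} {α β b : ℝ}
  {A : X → Matrix (Fin d) (Fin d) ℝ}

theorem integrable_bilin (hA : ∀ i j, AEMeasurable (fun x => A x i j) μ)
    (hb : ∀ᵐ x ∂μ, ∀ ξ η : EuclideanSpace ℝ (Fin d), |bilin (A x) ξ η| ≤ b * ‖ξ‖ * ‖η‖)
    (G H : Lp (EuclideanSpace ℝ (Fin d)) 2 μ) :
    Integrable (fun x => bilin (A x) (G x) (H x)) μ := by
  have hcoord (G : Lp (EuclideanSpace ℝ (Fin d)) 2 μ) (i : Fin d) :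
      AEMeasurable (fun x => G x i) μ :=
    (EuclideanSpace.proj i : EuclideanSpace ℝ (Fin d) →L[ℝ] ℝ).measurable.comp_aemeasurable
      (Lp.aestronglyMeasurable G).aemeasurable
  have hm : AEMeasurable (fun x => bilin (A x) (G x) (H x)) μ := by
    simp only [bilin_eq_sum]
    exact Finset.aemeasurable_fun_sum _ fun i _ => (hcoord G i).mul
      (Finset.aemeasurable_fun_sum _ fun j _ => (hA i j).mul (hcoord H j))
  refine Integrable.mono' (((Lp.memLp G).norm.integrable_mul (Lp.memLp H).norm).const_mul b)
    hm.aestronglyMeasurable ?_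
  filter_upwards [hb] with x hx
  simpa [mul_assoc] using hx (G x) (H x)

theorem abs_integral_bilin_le (hA : ∀ i j, AEMeasurable (fun x => A x i j) μ) (hb0 : 0 ≤ b)
    (hb : ∀ᵐ x ∂μ, ∀ ξ η : EuclideanSpace ℝ (Fin d), |bilin (A x) ξ η| ≤ b * ‖ξ‖ * ‖η‖)
    (G H : Lp (EuclideanSpace ℝ (Fin d)) 2 μ) :
    |∫ x, bilin (A x) (G x) (H x) ∂μ| ≤ b * ‖G‖ * ‖H‖ := by
  calc |∫ x, bilin (A x) (G x) (H x) ∂μ|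
      ≤ ∫ x, |bilin (A x) (G x) (H x)| ∂μ := abs_integral_le_integral_abs
    _ ≤ ∫ x, b * (‖G x‖ * ‖H x‖) ∂μ := by
        refine integral_mono_ae (integrable_bilin hA hb G H).abs
          (((Lp.memLp G).norm.integrable_mul (Lp.memLp H).norm).const_mul b) ?_
        filter_upwards [hb] with x hx
        simpa [mul_assoc] using hx (G x) (H x)
    _ = b * ∫ x, ‖G x‖ * ‖H x‖ ∂μ := integral_const_mul _ _
    _ ≤ b * (‖G‖ * ‖H‖) := by
        gcongr
        exact integral_norm_mul_norm_le G H
    _ = b * ‖G‖ * ‖H‖ := (mul_assoc _ _ _).symm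

/-- `A ∈ L^∞(μ, S_{α,β})`; the coefficient fields of the Neumann problem on `D` are those for
`μ = bulk D`. -/
structure IsCoeffField (μ : Measure X) (α β : ℝ) (A : X → Matrix (Fin d) (Fin d) ℝ) : Prop where
  aemeasurable : ∀ i j, AEMeasurable (fun x => A x i j) μ
  mem_coeffSet : ∀ᵐ x ∂μ, A x ∈ coeffSet d α β

theorem isCoeffField_const (μ : Measure X) {M : Matrix (Fin d) (Fin d) ℝ}
    (hM : M ∈ coeffSet d α β) : IsCoeffField μ α β fun _ => M :=
  ⟨fun _ _ => aemeasurable_const, .of_forall fun _ => hM⟩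

theorem IsPeriodicCoeff.isCoeffField_rescale
    {Aper : EuclideanSpace ℝ (Fin d) → Matrix (Fin d) (Fin d) ℝ} (hA : IsPeriodicCoeff α β Aper)
    {ε : ℝ} (hε : ε ≠ 0) : IsCoeffField volume α β (rescale Aper ε) := by
  have hq : Measure.QuasiMeasurePreserving (fun x : EuclideanSpace ℝ (Fin d) => ε⁻¹ • x) := by
    refine ⟨measurable_const_smul _, ?_⟩
    rw [Measure.map_addHaar_smul volume (inv_ne_zero hε)]
    exact Measure.smul_absolutelyContinuous
  exact ⟨fun i j => (hA.aemeasurable i j).comp_quasiMeasurePreserving hq, hq.ae hA.mem_coeffSet⟩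

namespace IsCoeffField

theorem restrict (hA : IsCoeffField μ α β A) (s : Set X) : IsCoeffField (μ.restrict s) α β A :=
  ⟨fun i j => (hA.aemeasurable i j).restrict, ae_restrict_of_ae hA.mem_coeffSet⟩

theorem coeffSet_nonempty [NeZero μ] (hA : IsCoeffField μ α β A) : (coeffSet d α β).Nonempty :=
  let ⟨x, hx⟩ := hA.mem_coeffSet.exists
  ⟨A x, hx⟩

theorem abs_bilin_le (hA : IsCoeffField μ α β A) :
    ∀ᵐ x ∂μ, ∀ ξ η : EuclideanSpace ℝ (Fin d), |bilin (A x) ξ η| ≤ |β| * ‖ξ‖ * ‖η‖ :=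
  hA.mem_coeffSet.mono fun _ hx ξ η => (hx.2.2 ξ η).trans (by gcongr; exact le_abs_self β)

theorem integrable_bilin (hA : IsCoeffField μ α β A) (G H : Lp (EuclideanSpace ℝ (Fin d)) 2 μ) :
    Integrable (fun x => bilin (A x) (G x) (H x)) μ :=
  EffectiveCoefficient.integrable_bilin hA.aemeasurable hA.abs_bilin_le G H

/-- The bilinear form `(G, H) ↦ ∫ Gᵀ A H` on square integrable vector fields. -/
def form (hA : IsCoeffField μ α β A) :
    Lp (EuclideanSpace ℝ (Fin d)) 2 μ →L[ℝ] Lp (EuclideanSpace ℝ (Fin d)) 2 μ →L[ℝ] ℝ :=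
  LinearMap.mkContinuous₂
    (LinearMap.mk₂ ℝ (fun G H : Lp (EuclideanSpace ℝ (Fin d)) 2 μ =>
        ∫ x, bilin (A x) (G x) (H x) ∂μ)
      (fun G G' H => by
        rw [← integral_add (hA.integrable_bilin G H) (hA.integrable_bilin G' H)]
        refine integral_congr_ae ((Lp.coeFn_add G G').mono fun x hx => ?_)
        simp only [hx, Pi.add_apply, bilin_add_left])
      (fun c G H => by
        rw [smul_eq_mul, ← integral_const_mul]
        refine integral_congr_ae ((Lp.coeFn_smul c G).mono fun x hx => ?_)
        simp only [hx, Pi.smul_apply, bilin_smul_left])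
      (fun G H H' => by
        rw [← integral_add (hA.integrable_bilin G H) (hA.integrable_bilin G H')]
        refine integral_congr_ae ((Lp.coeFn_add H H').mono fun x hx => ?_)
        simp only [hx, Pi.add_apply, bilin_add_right])
      (fun c G H => by
        rw [smul_eq_mul, ← integral_const_mul]
        refine integral_congr_ae ((Lp.coeFn_smul c H).mono fun x hx => ?_)
        simp only [hx, Pi.smul_apply, bilin_smul_right]))
    |β| (abs_integral_bilin_le hA.aemeasurable (abs_nonneg β) hA.abs_bilin_le)

theorem form_apply (hA : IsCoeffField μ α β A) (G H : Lp (EuclideanSpace ℝ (Fin d)) 2 μ) :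
    hA.form G H = ∫ x, bilin (A x) (G x) (H x) ∂μ := rfl

theorem form_comm (hA : IsCoeffField μ α β A) (G H : Lp (EuclideanSpace ℝ (Fin d)) 2 μ) :
    hA.form G H = hA.form H G :=
  integral_congr_ae (hA.mem_coeffSet.mono fun _ hx => bilin_comm hx.1 _ _)

theorem le_form (hA : IsCoeffField μ α β A) (G : Lp (EuclideanSpace ℝ (Fin d)) 2 μ) :
    α * ‖G‖ ^ 2 ≤ hA.form G G := by
  have hnorm : ‖G‖ ^ 2 = ∫ x, ‖G x‖ ^ 2 ∂μ := by
    simp only [← real_inner_self_eq_norm_sq, L2.inner_def]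
  rw [hnorm, ← integral_const_mul, hA.form_apply]
  refine integral_mono_ae ((Lp.memLp G).norm.integrable_sq.const_mul α)
    (hA.integrable_bilin G G) ?_
  filter_upwards [hA.mem_coeffSet] with x hx using hx.2.1 _

end IsCoeffField

end Form

section Gradient

variable {E : Type*} [NormedAddCommGroup E] [InnerProductSpace ℝ E] [CompleteSpace E]

theorem norm_gradient (φ : E → ℝ) (x : E) : ‖gradient φ x‖ = ‖fderiv ℝ φ x‖ := by
  simp [gradient]

theorem continuous_gradient {φ : E → ℝ} (hφ : ContDiff ℝ 1 φ) : Continuous (gradient φ) :=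
  (InnerProductSpace.toDual ℝ E).symm.continuous.comp (hφ.continuous_fderiv one_ne_zero)

theorem gradient_add {φ ψ : E → ℝ} {x : E} (hφ : DifferentiableAt ℝ φ x)
    (hψ : DifferentiableAt ℝ ψ x) : gradient (φ + ψ) x = gradient φ x + gradient ψ x := by
  simp [gradient, fderiv_add hφ hψ]

theorem gradient_const_smul (c : ℝ) (φ : E → ℝ) (x : E) :
    gradient (c • φ) x = c • gradient φ x := by
  simp [gradient, fderiv_const_smul_field]

end Gradient

theorem gradient_apply {ι : Type*} [Fintype ι] [DecidableEq ι] (φ : EuclideanSpace ℝ ι → ℝ)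
    (x : EuclideanSpace ℝ ι) (i : ι) :
    gradient φ x i = fderiv ℝ φ x (EuclideanSpace.single i 1) := by
  rw [← inner_gradient_left, EuclideanSpace.inner_single_right]
  simp

theorem setIntegral_mul_gradient_eq_neg {ι : Type*} [Fintype ι] {D : Set (EuclideanSpace ℝ ι)}
    {φ ψ : EuclideanSpace ℝ ι → ℝ} (hφ : ContDiff ℝ 1 φ) (hψ : ContDiff ℝ 1 ψ)
    (hc : HasCompactSupport ψ) (hψD : tsupport ψ ⊆ D) (i : ι) :
    ∫ x in D, φ x * gradient ψ x i = -∫ x in D, gradient φ x i * ψ x := by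
  classical
  simp only [gradient_apply]
  set e : EuclideanSpace ℝ ι := EuclideanSpace.single i 1
  have hφ' : Continuous fun x => fderiv ℝ φ x e :=
    (hφ.continuous_fderiv one_ne_zero).clm_apply continuous_const
  have hψ' : Continuous fun x => fderiv ℝ ψ x e :=
    (hψ.continuous_fderiv one_ne_zero).clm_apply continuous_const
  have hψ0 {x} (hx : x ∉ D) : ψ x = 0 := image_eq_zero_of_notMem_tsupport fun h => hx (hψD h)
  have hfderiv0 {x} (hx : x ∉ D) : fderiv ℝ ψ x = 0 := by
    by_contra h
    exact hx (hψD (support_fderiv_subset ℝ h))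
  rw [setIntegral_eq_integral_of_forall_compl_eq_zero fun x hx => by simp [hfderiv0 hx],
    setIntegral_eq_integral_of_forall_compl_eq_zero fun x hx => by simp [hψ0 hx]]
  refine integral_mul_fderiv_eq_neg_fderiv_mul_of_integrable ?_ ?_ ?_ ?_ ?_
  · exact (hφ'.mul hψ.continuous).integrable_of_hasCompactSupport hc.mul_left
  · exact (hφ.continuous.mul hψ').integrable_of_hasCompactSupport (hc.fderiv_apply ℝ e).mul_left
  · exact (hφ.continuous.mul hψ.continuous).integrable_of_hasCompactSupport hc.mul_left
  · exact fun x _ => hφ.differentiable one_ne_zero x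
  · exact fun x _ => hψ.differentiable one_ne_zero x

section TripleSpace

variable {d : ℕ} {D : Set (EuclideanSpace ℝ (Fin d))}

/-- The Hilbert space `L²(D) × L²(D; ℝᵈ) × L²(∂D)` in which `H¹(D)` lives by way of
`u ↦ (u, ∇u, u|∂D)`. -/
abbrev TripleSpace (D : Set (EuclideanSpace ℝ (Fin d))) : Type :=
  WithLp 2 (Lp ℝ 2 (bulk D) ×
    WithLp 2 (Lp (EuclideanSpace ℝ (Fin d)) 2 (bulk D) × Lp ℝ 2 (surf D)))

variable (D) in
/-- The first component of a triple: the function itself. -/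
def valL : TripleSpace D →L[ℝ] Lp ℝ 2 (bulk D) := WithLp.fstL 2 ℝ _ _

variable (D) in
/-- The second component of a triple: the gradient. -/
def gradL : TripleSpace D →L[ℝ] Lp (EuclideanSpace ℝ (Fin d)) 2 (bulk D) :=
  (WithLp.fstL 2 ℝ _ _).comp (WithLp.sndL 2 ℝ _ _)

variable (D) in
/-- The third component of a triple: the boundary trace. -/
def traceL : TripleSpace D →L[ℝ] Lp ℝ 2 (surf D) :=
  (WithLp.sndL 2 ℝ _ _).comp (WithLp.sndL 2 ℝ _ _)

/-- The triple with the given components. -/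
def mkTriple (f : Lp ℝ 2 (bulk D)) (G : Lp (EuclideanSpace ℝ (Fin d)) 2 (bulk D))
    (t : Lp ℝ 2 (surf D)) : TripleSpace D :=
  WithLp.toLp 2 (f, WithLp.toLp 2 (G, t))

theorem tendsto_mkTriple {ι : Type*} {l : Filter ι} {f : ι → Lp ℝ 2 (bulk D)}
    {G : ι → Lp (EuclideanSpace ℝ (Fin d)) 2 (bulk D)} {t : ι → Lp ℝ 2 (surf D)}
    {f' : Lp ℝ 2 (bulk D)} {G' : Lp (EuclideanSpace ℝ (Fin d)) 2 (bulk D)}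
    {t' : Lp ℝ 2 (surf D)} (hf : Tendsto f l (𝓝 f')) (hG : Tendsto G l (𝓝 G'))
    (ht : Tendsto t l (𝓝 t')) :
    Tendsto (fun i => mkTriple (f i) (G i) (t i)) l (𝓝 (mkTriple f' G' t')) :=
  ((WithLp.prod_continuous_toLp 2 _ _).tendsto (f', WithLp.toLp 2 (G', t'))).comp
    (hf.prodMk_nhds
      (((WithLp.prod_continuous_toLp 2 _ _).tendsto (G', t')).comp (hG.prodMk_nhds ht)))

theorem norm_gradL_apply_le (z : TripleSpace D) : ‖gradL D z‖ ≤ ‖z‖ :=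
  (WithLp.norm_fst_le _ z.snd).trans (WithLp.norm_snd_le _ z)

theorem norm_traceL_apply_le (z : TripleSpace D) : ‖traceL D z‖ ≤ ‖z‖ :=
  (WithLp.norm_snd_le _ z.snd).trans (WithLp.norm_snd_le _ z)

theorem enorm_le_add_enorm_add_enorm (z : TripleSpace D) :
    ‖z‖ₑ ≤ ‖valL D z‖ₑ + ‖gradL D z‖ₑ + ‖traceL D z‖ₑ := by
  have hsq : ‖z‖ ^ 2 = ‖valL D z‖ ^ 2 + (‖gradL D z‖ ^ 2 + ‖traceL D z‖ ^ 2) := by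
    rw [WithLp.prod_norm_sq_eq_of_L2, WithLp.prod_norm_sq_eq_of_L2]
    rfl
  have hnorm : ‖z‖ ≤ ‖valL D z‖ + ‖gradL D z‖ + ‖traceL D z‖ := by
    refine (sq_le_sq₀ (norm_nonneg _) (by positivity)).1 ?_
    nlinarith [norm_nonneg (valL D z), norm_nonneg (gradL D z), norm_nonneg (traceL D z)]
  simp only [enorm_eq_nnnorm]
  exact_mod_cast hnorm

/-- `z` is the triple `(φ, ∇φ, φ|∂D)` of the function `φ`, smooth up to the boundary. -/
structure IsSmoothTriple (z : TripleSpace D) (φ : EuclideanSpace ℝ (Fin d) → ℝ) : Prop where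
  contDiff : ContDiff ℝ ∞ φ
  val_eq : valL D z =ᵐ[bulk D] φ
  grad_eq : gradL D z =ᵐ[bulk D] gradient φ
  trace_eq : traceL D z =ᵐ[surf D] φ

namespace IsSmoothTriple

variable {z w : TripleSpace D} {φ ψ : EuclideanSpace ℝ (Fin d) → ℝ}

theorem contDiff_one (h : IsSmoothTriple z φ) : ContDiff ℝ 1 φ :=
  h.contDiff.of_le (by exact_mod_cast le_top)

theorem zero : IsSmoothTriple (0 : TripleSpace D) 0 where
  contDiff := contDiff_const
  val_eq := by
    rw [map_zero]
    exact Lp.coeFn_zero _ _ _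
  grad_eq := by
    rw [map_zero]
    exact (Lp.coeFn_zero _ _ _).trans (.of_forall fun x => (gradient_const x 0).symm)
  trace_eq := by
    rw [map_zero]
    exact Lp.coeFn_zero _ _ _

theorem add (hz : IsSmoothTriple z φ) (hw : IsSmoothTriple w ψ) :
    IsSmoothTriple (z + w) (φ + ψ) where
  contDiff := hz.contDiff.add hw.contDiff
  val_eq := by
    rw [map_add]
    exact (Lp.coeFn_add _ _).trans (hz.val_eq.add hw.val_eq)
  grad_eq := by
    rw [map_add]
    refine (Lp.coeFn_add _ _).trans ((hz.grad_eq.add hw.grad_eq).trans (.of_forall fun x => ?_))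
    exact (gradient_add (hz.contDiff_one.differentiable one_ne_zero x)
      (hw.contDiff_one.differentiable one_ne_zero x)).symm
  trace_eq := by
    rw [map_add]
    exact (Lp.coeFn_add _ _).trans (hz.trace_eq.add hw.trace_eq)

theorem smul (hz : IsSmoothTriple z φ) (c : ℝ) : IsSmoothTriple (c • z) (c • φ) where
  contDiff := hz.contDiff.const_smul c
  val_eq := by
    rw [map_smul]
    exact (Lp.coeFn_smul _ _).trans (hz.val_eq.const_smul c)
  grad_eq := by
    rw [map_smul]
    exact (Lp.coeFn_smul _ _).trans ((hz.grad_eq.const_smul c).trans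
      (.of_forall fun x => (gradient_const_smul c φ x).symm))
  trace_eq := by
    rw [map_smul]
    exact (Lp.coeFn_smul _ _).trans (hz.trace_eq.const_smul c)

theorem enorm_valL (h : IsSmoothTriple z φ) : ‖valL D z‖ₑ = eLpNorm φ 2 (bulk D) := by
  rw [Lp.enorm_def, eLpNorm_congr_ae h.val_eq]

theorem enorm_gradL (h : IsSmoothTriple z φ) :
    ‖gradL D z‖ₑ = eLpNorm (fderiv ℝ φ) 2 (bulk D) := by
  rw [Lp.enorm_def, eLpNorm_congr_ae h.grad_eq]
  exact eLpNorm_congr_norm_ae (.of_forall (norm_gradient φ))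

theorem enorm_traceL (h : IsSmoothTriple z φ) : ‖traceL D z‖ₑ = eLpNorm φ 2 (surf D) := by
  rw [Lp.enorm_def, eLpNorm_congr_ae h.trace_eq]

end IsSmoothTriple

variable (D) in
/-- The triples of functions that are smooth up to the boundary. -/
def smoothTriples : Submodule ℝ (TripleSpace D) where
  carrier := {z | ∃ φ, IsSmoothTriple z φ}
  add_mem' := fun ⟨_, hφ⟩ ⟨_, hψ⟩ => ⟨_, hφ.add hψ⟩
  zero_mem' := ⟨_, .zero⟩
  smul_mem' := fun c _ ⟨_, hφ⟩ => ⟨_, hφ.smul c⟩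

variable (D) in
/-- `H¹(D)` as the closure of the smooth functions. -/
def sobolev : Submodule ℝ (TripleSpace D) := (smoothTriples D).topologicalClosure

namespace IsLipschitzDomain

/-- The triple of a function that is smooth up to the boundary. -/
def triple (hD : IsLipschitzDomain D) {φ : EuclideanSpace ℝ (Fin d) → ℝ}
    (hφ : ContDiff ℝ ∞ φ) : TripleSpace D :=
  mkTriple ((hD.memLp_bulk hφ.continuous 2).toLp φ)
    ((hD.memLp_bulk (continuous_gradient (hφ.of_le (by exact_mod_cast le_top))) 2).toLp
      (gradient φ))
    ((hD.memLp_surf hφ.continuous 2).toLp φ)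

theorem isSmoothTriple_triple (hD : IsLipschitzDomain D)
    {φ : EuclideanSpace ℝ (Fin d) → ℝ} (hφ : ContDiff ℝ ∞ φ) :
    IsSmoothTriple (hD.triple hφ) φ :=
  ⟨hφ, (hD.memLp_bulk hφ.continuous 2).coeFn_toLp,
    (hD.memLp_bulk (continuous_gradient (hφ.of_le (by exact_mod_cast le_top))) 2).coeFn_toLp,
    (hD.memLp_surf hφ.continuous 2).coeFn_toLp⟩

/-- The triple `(1, 0, 1)` of the constant function `1`. -/
def one (hD : IsLipschitzDomain D) : TripleSpace D :=
  hD.triple (φ := fun _ => 1) contDiff_const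

theorem isSmoothTriple_one (hD : IsLipschitzDomain D) : IsSmoothTriple hD.one fun _ => 1 :=
  hD.isSmoothTriple_triple _

theorem one_mem_sobolev (hD : IsLipschitzDomain D) : hD.one ∈ sobolev D :=
  Submodule.le_topologicalClosure _ ⟨_, hD.isSmoothTriple_one⟩

theorem gradL_one (hD : IsLipschitzDomain D) : gradL D hD.one = 0 :=
  Lp.ext (hD.isSmoothTriple_one.grad_eq.trans
    (.trans (.of_forall fun x => gradient_const x 1) (Lp.coeFn_zero _ _ _).symm))

/-- The integral of the trace over `∂D`; it is written as an inner product with the trace of `1`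
to make its continuity evident. -/
def traceIntegral (hD : IsLipschitzDomain D) : TripleSpace D →L[ℝ] ℝ :=
  (innerSL ℝ (traceL D hD.one)).comp (traceL D)

theorem inner_traceL_one (hD : IsLipschitzDomain D) (t : Lp ℝ 2 (surf D)) :
    inner ℝ (traceL D hD.one) t = ∫ x, t x ∂(surf D) := by
  rw [L2.inner_def]
  refine integral_congr_ae (hD.isSmoothTriple_one.trace_eq.mono fun x hx => ?_)
  simp [hx]

theorem traceIntegral_apply (hD : IsLipschitzDomain D) (z : TripleSpace D) :
    hD.traceIntegral z = ∫ x, traceL D z x ∂(surf D) :=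
  hD.inner_traceL_one _

theorem traceIntegral_one_ne_zero (hd : 1 ≤ d) (hD : IsLipschitzDomain D) :
    hD.traceIntegral hD.one ≠ 0 := by
  have := hD.isFiniteMeasure_surf
  rw [hD.traceIntegral_apply, integral_congr_ae hD.isSmoothTriple_one.trace_eq]
  simpa [Measure.real] using
    (ENNReal.toReal_pos (hD.surf_univ_pos hd).ne' (measure_ne_top _ _)).ne'

theorem exists_norm_sub_smul_one_le (hD : IsLipschitzDomain D) :
    ∃ C : ℝ≥0, ∀ z ∈ smoothTriples D, ∃ c : ℝ, ‖z - c • hD.one‖ ≤ C * ‖gradL D z‖ := by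
  obtain ⟨C₁, hpoincare⟩ := hD.hasSegmentProperty.exists_eLpNorm_sub_const_le ℝ volume
    one_le_two hD.isOpen hD.isConnected hD.isBounded
  obtain ⟨C₂, htrace⟩ := hD.exists_eLpNorm_trace_le ℝ one_le_two
  rw [ENNReal.coe_ofNat] at hpoincare htrace
  refine ⟨C₁ + 1 + C₂ * (C₁ + 1), ?_⟩
  rintro z ⟨φ, hφ⟩
  obtain ⟨c, hc⟩ := hpoincare φ hφ.contDiff_one
  refine ⟨c, ?_⟩
  have hw : IsSmoothTriple (z - c • hD.one) fun x => φ x - c := by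
    simpa [sub_eq_add_neg, Pi.add_def] using hφ.add (hD.isSmoothTriple_one.smul (-c))
  have hgrad : gradL D (z - c • hD.one) = gradL D z := by simp [hD.gradL_one]
  have hval : ‖valL D (z - c • hD.one)‖ₑ ≤ C₁ * ‖gradL D z‖ₑ := by
    rwa [hw.enorm_valL, hφ.enorm_gradL]
  have htr : ‖traceL D (z - c • hD.one)‖ₑ ≤ C₂ * (C₁ * ‖gradL D z‖ₑ + ‖gradL D z‖ₑ) := by
    calc ‖traceL D (z - c • hD.one)‖ₑ
        ≤ C₂ * (‖valL D (z - c • hD.one)‖ₑ + ‖gradL D (z - c • hD.one)‖ₑ) := by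
          rw [hw.enorm_traceL, hw.enorm_valL, hw.enorm_gradL]
          exact htrace _ hw.contDiff_one
      _ ≤ C₂ * (C₁ * ‖gradL D z‖ₑ + ‖gradL D z‖ₑ) := by rw [hgrad]; gcongr
  have h : ‖z - c • hD.one‖ₑ ≤ (C₁ + 1 + C₂ * (C₁ + 1)) * ‖gradL D z‖ₑ := by
    calc ‖z - c • hD.one‖ₑ
        ≤ C₁ * ‖gradL D z‖ₑ + ‖gradL D z‖ₑ + C₂ * (C₁ * ‖gradL D z‖ₑ + ‖gradL D z‖ₑ) := by
          refine (enorm_le_add_enorm_add_enorm _).trans ?_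
          rw [hgrad]
          gcongr
      _ = (C₁ + 1 + C₂ * (C₁ + 1)) * ‖gradL D z‖ₑ := by ring
  simp only [enorm_eq_nnnorm] at h
  exact_mod_cast h

theorem exists_norm_le_gradL (hd : 1 ≤ d) (hD : IsLipschitzDomain D) :
    ∃ C > 0, ∀ z ∈ sobolev D, hD.traceIntegral z = 0 → ‖z‖ ≤ C * ‖gradL D z‖ :=
  let ⟨_, hC⟩ := hD.exists_norm_sub_smul_one_le
  exists_norm_le_of_norm_sub_smul_le (gradL D) hD.traceIntegral
    (hD.traceIntegral_one_ne_zero hd) hC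

end IsLipschitzDomain

end TripleSpace

section Correspondence

variable {d : ℕ} {D : Set (EuclideanSpace ℝ (Fin d))}

/-- The triple `(u, ∇u, u|∂D)` of an element of `H¹(D)`. -/
def H1.toTriple (u : H1 D) : TripleSpace D :=
  mkTriple (u.memLp_toFun.toLp _) (u.memLp_grad.toLp _) (u.memLp_trace.toLp _)

theorem H1.val_toTriple (u : H1 D) : valL D u.toTriple =ᵐ[bulk D] u.toFun :=
  u.memLp_toFun.coeFn_toLp

theorem H1.grad_toTriple (u : H1 D) : gradL D u.toTriple =ᵐ[bulk D] u.grad :=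
  u.memLp_grad.coeFn_toLp

theorem H1.trace_toTriple (u : H1 D) : traceL D u.toTriple =ᵐ[surf D] u.trace :=
  u.memLp_trace.coeFn_toLp

theorem IsLipschitzDomain.toTriple_mem_sobolev (hD : IsLipschitzDomain D) (u : H1 D) :
    u.toTriple ∈ sobolev D := by
  obtain ⟨φ, hφ, hval, hgrad, htrace⟩ := u.isTrace
  refine mem_closure_of_tendsto (f := fun n => hD.triple (hφ n)) (b := atTop) ?_
    (.of_forall fun n => ⟨φ n, hD.isSmoothTriple_triple (hφ n)⟩)
  exact tendsto_mkTriple ((Lp.tendsto_Lp_iff_tendsto_eLpNorm'' _ _ _ _).2 hval)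
    ((Lp.tendsto_Lp_iff_tendsto_eLpNorm'' _ _ _ _).2 hgrad)
    ((Lp.tendsto_Lp_iff_tendsto_eLpNorm'' _ _ _ _).2 htrace)

theorem IsLipschitzDomain.hasWeakGradient_of_mem_sobolev (hD : IsLipschitzDomain D)
    {z : TripleSpace D} (hz : z ∈ sobolev D) : HasWeakGradient D (valL D z) (gradL D z) := by
  intro ψ hψ hc hψD i
  have hψ1 : ContDiff ℝ 1 ψ := hψ.of_le (by exact_mod_cast le_top)
  have hmem₁ : MemLp (fun x => gradient ψ x i) 2 (bulk D) := hD.memLp_bulk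
    ((EuclideanSpace.proj i : EuclideanSpace ℝ (Fin d) →L[ℝ] ℝ).continuous.comp
      (continuous_gradient hψ1)) 2
  have hmem₂ : MemLp (fun x => ψ x • EuclideanSpace.single i (1 : ℝ)) 2 (bulk D) :=
    hD.memLp_bulk (hψ.continuous.smul continuous_const) 2
  have hleft (z : TripleSpace D) :
      ∫ x in D, valL D z x * gradient ψ x i = inner ℝ (hmem₁.toLp _) (valL D z) := by
    rw [L2.inner_def]
    refine integral_congr_ae (hmem₁.coeFn_toLp.mono fun x hx => ?_)
    simp [hx]
  have hright (z : TripleSpace D) :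
      ∫ x in D, gradL D z x i * ψ x = inner ℝ (hmem₂.toLp _) (gradL D z) := by
    rw [L2.inner_def]
    refine integral_congr_ae (hmem₂.coeFn_toLp.mono fun x hx => ?_)
    simp [hx, inner_smul_left, EuclideanSpace.inner_single_left, mul_comm]
  rw [hleft, hright]
  have hcl : IsClosed {z : TripleSpace D |
      inner ℝ (hmem₁.toLp _) (valL D z) = -inner ℝ (hmem₂.toLp _) (gradL D z)} :=
    isClosed_eq (by fun_prop) (by fun_prop)
  refine hcl.closure_subset_iff.2 ?_ hz
  rintro w ⟨φ, hφ⟩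
  have hval : ∫ x in D, valL D w x * gradient ψ x i = ∫ x in D, φ x * gradient ψ x i :=
    integral_congr_ae (hφ.val_eq.mono fun x hx => by simp only [hx])
  have hgrad : ∫ x in D, gradL D w x i * ψ x = ∫ x in D, gradient φ x i * ψ x :=
    integral_congr_ae (hφ.grad_eq.mono fun x hx => by simp only [hx])
  rw [Set.mem_ofPred_eq, ← hleft, ← hright, hval, hgrad]
  exact setIntegral_mul_gradient_eq_neg hφ.contDiff_one hψ1 hc hψD i

theorem isTrace_of_mem_sobolev {z : TripleSpace D} (hz : z ∈ sobolev D) :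
    IsTrace D (valL D z) (gradL D z) (traceL D z) := by
  obtain ⟨w, hw, hlim⟩ := mem_closure_iff_seq_limit.1 hz
  choose φ hφ using hw
  refine ⟨φ, fun n => (hφ n).contDiff, ?_, ?_, ?_⟩
  · refine ((Lp.tendsto_Lp_iff_tendsto_eLpNorm' _ _).1
      (((valL D).continuous.tendsto z).comp hlim)).congr fun n => eLpNorm_congr_ae ?_
    exact (hφ n).val_eq.mono fun x hx => by simp [hx]
  · refine ((Lp.tendsto_Lp_iff_tendsto_eLpNorm' _ _).1
      (((gradL D).continuous.tendsto z).comp hlim)).congr fun n => eLpNorm_congr_ae ?_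
    exact (hφ n).grad_eq.mono fun x hx => by simp [hx]
  · refine ((Lp.tendsto_Lp_iff_tendsto_eLpNorm' _ _).1
      (((traceL D).continuous.tendsto z).comp hlim)).congr fun n => eLpNorm_congr_ae ?_
    exact (hφ n).trace_eq.mono fun x hx => by simp [hx]

theorem IsLipschitzDomain.exists_toTriple_eq (hD : IsLipschitzDomain D)
    {z : TripleSpace D} (hz : z ∈ sobolev D) : ∃ u : H1 D, u.toTriple = z := by
  refine ⟨⟨valL D z, gradL D z, traceL D z, Lp.memLp _, Lp.memLp _, Lp.memLp _,
    hD.hasWeakGradient_of_mem_sobolev hz, isTrace_of_mem_sobolev hz⟩, ?_⟩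
  simp only [H1.toTriple, Lp.toLp_coeFn]
  rfl

variable {α β : ℝ} {A : EuclideanSpace ℝ (Fin d) → Matrix (Fin d) (Fin d) ℝ}

theorem H1.form_toTriple (hA : IsCoeffField (bulk D) α β A) (v u : H1 D) :
    hA.form (gradL D v.toTriple) (gradL D u.toTriple) =
      ∫ x in D, bilin (A x) (v.grad x) (u.grad x) := by
  rw [hA.form_apply]
  refine integral_congr_ae ?_
  filter_upwards [v.grad_toTriple, u.grad_toTriple] with x hv hu
  rw [hv, hu]

theorem H1.inner_toTriple (g : Lp ℝ 2 (surf D)) (v : H1 D) :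
    inner ℝ g (traceL D v.toTriple) = ∫ x, g x * v.trace x ∂(surf D) := by
  rw [L2.inner_def]
  refine integral_congr_ae (v.trace_toTriple.mono fun x hx => ?_)
  simp [hx, mul_comm]

theorem IsLipschitzDomain.traceIntegral_toTriple (hD : IsLipschitzDomain D) (u : H1 D) :
    hD.traceIntegral u.toTriple = ∫ x, u.trace x ∂(surf D) := by
  rw [hD.traceIntegral_apply]
  exact integral_congr_ae u.trace_toTriple

end Correspondence

section WeakSolution

variable {d : ℕ} {D : Set (EuclideanSpace ℝ (Fin d))} {α β : ℝ}
  {A : EuclideanSpace ℝ (Fin d) → Matrix (Fin d) (Fin d) ℝ} {g h : Lp ℝ 2 (surf D)}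
  {z w : TripleSpace D}

/-- The weak formulation of the Neumann problem, for triples in place of elements of `H1 D`. -/
structure IsWeakSolution (hD : IsLipschitzDomain D) (hA : IsCoeffField (bulk D) α β A)
    (g : Lp ℝ 2 (surf D)) (z : TripleSpace D) : Prop where
  mem_sobolev : z ∈ sobolev D
  traceIntegral_eq_zero : hD.traceIntegral z = 0
  form_eq : ∀ v ∈ sobolev D, hA.form (gradL D z) (gradL D v) = inner ℝ g (traceL D v)

theorem isNeumannSolution_iff (hD : IsLipschitzDomain D) (hA : IsCoeffField (bulk D) α β A)
    (g : Lp ℝ 2 (surf D)) (u : H1 D) :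
    IsNeumannSolution D A g u ↔ IsWeakSolution hD hA g u.toTriple := by
  constructor
  · rintro ⟨hmean, hweak⟩
    refine ⟨hD.toTriple_mem_sobolev u, by rwa [hD.traceIntegral_toTriple], fun v hv => ?_⟩
    obtain ⟨v, rfl⟩ := hD.exists_toTriple_eq hv
    rw [hA.form_comm, H1.form_toTriple, H1.inner_toTriple, hweak v]
  · rintro ⟨-, hmean, hweak⟩
    refine ⟨by rwa [← hD.traceIntegral_toTriple], fun v => ?_⟩
    rw [← H1.form_toTriple hA, ← H1.inner_toTriple, hA.form_comm,
      hweak _ (hD.toTriple_mem_sobolev v)]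

theorem IsWeakSolution.sub {hD : IsLipschitzDomain D} {hA : IsCoeffField (bulk D) α β A}
    (hz : IsWeakSolution hD hA g z) (hw : IsWeakSolution hD hA h w) :
    IsWeakSolution hD hA (g - h) (z - w) where
  mem_sobolev := Submodule.sub_mem _ hz.mem_sobolev hw.mem_sobolev
  traceIntegral_eq_zero := by
    rw [map_sub, hz.traceIntegral_eq_zero, hw.traceIntegral_eq_zero, sub_zero]
  form_eq v hv := by
    rw [map_sub, map_sub, sub_apply, hz.form_eq v hv, hw.form_eq v hv,
      inner_sub_left]

namespace IsLipschitzDomain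

theorem exists_mul_norm_mul_norm_le_form (hd : 1 ≤ d) (hD : IsLipschitzDomain D) (hα : 0 < α) :
    ∃ c > 0, ∀ (β : ℝ) {A : EuclideanSpace ℝ (Fin d) → Matrix (Fin d) (Fin d) ℝ}
      (hA : IsCoeffField (bulk D) α β A), ∀ z ∈ sobolev D, hD.traceIntegral z = 0 →
        c * ‖z‖ * ‖z‖ ≤ hA.form (gradL D z) (gradL D z) := by
  obtain ⟨C, hC0, hC⟩ := hD.exists_norm_le_gradL hd
  refine ⟨α / C ^ 2, by positivity, fun β A hA z hz hmean => ?_⟩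
  have hz' : ‖z‖ ≤ C * ‖gradL D z‖ := hC z hz hmean
  calc α / C ^ 2 * ‖z‖ * ‖z‖ ≤ α / C ^ 2 * (C * ‖gradL D z‖) * (C * ‖gradL D z‖) := by gcongr
    _ = α * ‖gradL D z‖ ^ 2 := by field_simp
    _ ≤ hA.form (gradL D z) (gradL D z) := hA.le_form (gradL D z)

theorem exists_isWeakSolution (hd : 1 ≤ d) (hD : IsLipschitzDomain D) (hα : 0 < α)
    (hA : IsCoeffField (bulk D) α β A) (hg : g ∈ L2m D) : ∃ z, IsWeakSolution hD hA g z := by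
  obtain ⟨c, hc0, hc⟩ := hD.exists_mul_norm_mul_norm_le_form hd hα
  have hgone : inner ℝ g (traceL D hD.one) = 0 := by
    rw [real_inner_comm, hD.inner_traceL_one]
    exact hg
  obtain ⟨z, hz, hmean, hweak⟩ := exists_mem_ker_forall_eq_of_coercive
    (b := hA.form.bilinearComp (gradL D) (gradL D)) (ℓ := (innerSL ℝ g).comp (traceL D))
    (smoothTriples D).isClosed_topologicalClosure hc0 (hc β hA) hD.one_mem_sobolev
    (hD.traceIntegral_one_ne_zero hd) (fun u => by simp [hD.gradL_one]) hgone
  exact ⟨z, hz, hmean, hweak⟩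

theorem exists_norm_le_of_isWeakSolution (hd : 1 ≤ d) (hD : IsLipschitzDomain D) (hα : 0 < α) :
    ∃ C ≥ 0, ∀ (β : ℝ) {A : EuclideanSpace ℝ (Fin d) → Matrix (Fin d) (Fin d) ℝ}
      (hA : IsCoeffField (bulk D) α β A) (g : Lp ℝ 2 (surf D)) (z : TripleSpace D),
        IsWeakSolution hD hA g z → ‖z‖ ≤ C * ‖g‖ := by
  obtain ⟨c, hc0, hc⟩ := hD.exists_mul_norm_mul_norm_le_form hd hα
  refine ⟨c⁻¹, by positivity, fun β A hA g z hz => ?_⟩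
  have henergy : c * ‖z‖ * ‖z‖ ≤ ‖g‖ * ‖z‖ := by
    calc c * ‖z‖ * ‖z‖ ≤ hA.form (gradL D z) (gradL D z) :=
          hc β hA z hz.mem_sobolev hz.traceIntegral_eq_zero
      _ = inner ℝ g (traceL D z) := hz.form_eq z hz.mem_sobolev
      _ ≤ ‖g‖ * ‖traceL D z‖ := real_inner_le_norm _ _
      _ ≤ ‖g‖ * ‖z‖ := by gcongr; exact norm_traceL_apply_le z
  rw [← div_eq_inv_mul, le_div_iff₀' hc0]
  rcases (norm_nonneg z).eq_or_lt with hz0 | hz0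
  · simp [← hz0]
  · exact le_of_mul_le_mul_right henergy hz0

theorem eq_of_isWeakSolution (hd : 1 ≤ d) (hD : IsLipschitzDomain D) (hα : 0 < α)
    (hA : IsCoeffField (bulk D) α β A) (hz : IsWeakSolution hD hA g z)
    (hw : IsWeakSolution hD hA g w) : z = w := by
  obtain ⟨C, -, hC⟩ := hD.exists_norm_le_of_isWeakSolution hd hα
  simpa [sub_eq_zero] using hC β hA _ _ (hz.sub hw)

theorem exists_isNeumannSolution (hd : 1 ≤ d) (hD : IsLipschitzDomain D) (hα : 0 < α)
    (hA : IsCoeffField (bulk D) α β A) (hg : g ∈ L2m D) : ∃ u, IsNeumannSolution D A g u := by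
  obtain ⟨z, hz⟩ := hD.exists_isWeakSolution hd hα hA hg
  obtain ⟨u, rfl⟩ := hD.exists_toTriple_eq hz.mem_sobolev
  exact ⟨u, (isNeumannSolution_iff hD hA g u).2 hz⟩

theorem wellPosed (hd : 1 ≤ d) (hD : IsLipschitzDomain D) (hα : 0 < α)
    (hA : IsCoeffField (bulk D) α β A) (hg : g ∈ L2m D) : WellPosed D A g := by
  obtain ⟨u, hu⟩ := hD.exists_isNeumannSolution hd hα hA hg
  refine ⟨u, hu, fun w hw => w.val_toTriple.symm.trans ?_⟩
  rw [hD.eq_of_isWeakSolution hd hα hA ((isNeumannSolution_iff hD hA g w).1 hw)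
    ((isNeumannSolution_iff hD hA g u).1 hu)]
  exact u.val_toTriple

end IsLipschitzDomain

end WeakSolution

section Energy

variable {d : ℕ} {D : Set (EuclideanSpace ℝ (Fin d))} {α β : ℝ}
  {A B : EuclideanSpace ℝ (Fin d) → Matrix (Fin d) (Fin d) ℝ} {g : Lp ℝ 2 (surf D)}

theorem IsWeakSolution.inner_sub_inner {hD : IsLipschitzDomain D}
    {hA : IsCoeffField (bulk D) α β A} {hB : IsCoeffField (bulk D) α β B} {z w : TripleSpace D}
    (hz : IsWeakSolution hD hA g z) (hw : IsWeakSolution hD hB g w) :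
    inner ℝ g (traceL D w) - inner ℝ g (traceL D z) =
      ∫ x in D, bilin (A x - B x) (gradL D z x) (gradL D w x) := by
  simp only [bilin_sub_matrix]
  rw [integral_sub (hA.integrable_bilin _ _) (hB.integrable_bilin _ _), ← hA.form_apply,
    ← hB.form_apply, hz.form_eq w hw.mem_sobolev, hB.form_comm, hw.form_eq z hz.mem_sobolev]

namespace IsLipschitzDomain

theorem exists_energy_eq (hd : 1 ≤ d) (hD : IsLipschitzDomain D) (hα : 0 < α)
    (hA : IsCoeffField (bulk D) α β A) (hg : g ∈ L2m D) :
    ∃ z, IsWeakSolution hD hA g z ∧ energy D A g = -(1 / 2) * inner ℝ g (traceL D z) := by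
  have h := hD.exists_isNeumannSolution hd hα hA hg
  refine ⟨h.choose.toTriple, (isNeumannSolution_iff hD hA g _).1 h.choose_spec, ?_⟩
  rw [energy, dif_pos h, h.choose_spec.2 h.choose, H1.inner_toTriple]
  ring

theorem exists_abs_energy_sub_energy_le (hd : 1 ≤ d) (hD : IsLipschitzDomain D) (hα : 0 < α) :
    ∃ C : ℝ, ∀ (β : ℝ) {A B : EuclideanSpace ℝ (Fin d) → Matrix (Fin d) (Fin d) ℝ},
      IsCoeffField (bulk D) α β A → IsCoeffField (bulk D) α β B → ∀ b ≥ 0,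
      (∀ᵐ x ∂(bulk D), ∀ ξ η : EuclideanSpace ℝ (Fin d),
        |bilin (A x - B x) ξ η| ≤ b * ‖ξ‖ * ‖η‖) →
      ∀ g ∈ L2m D, |energy D A g - energy D B g| ≤ C * b * ‖g‖ ^ 2 := by
  obtain ⟨C, hC0, hC⟩ := hD.exists_norm_le_of_isWeakSolution hd hα
  refine ⟨1 / 2 * C ^ 2, fun β A B hA hB b hb hAB g hg => ?_⟩
  obtain ⟨z, hz, hEA⟩ := hD.exists_energy_eq hd hα hA hg
  obtain ⟨w, hw, hEB⟩ := hD.exists_energy_eq hd hα hB hg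
  have hdiff : energy D A g - energy D B g =
      1 / 2 * ∫ x in D, bilin (A x - B x) (gradL D z x) (gradL D w x) := by
    rw [← hz.inner_sub_inner hw, hEA, hEB]
    ring
  have hgradz : ‖gradL D z‖ ≤ C * ‖g‖ := (norm_gradL_apply_le z).trans (hC β hA g z hz)
  have hgradw : ‖gradL D w‖ ≤ C * ‖g‖ := (norm_gradL_apply_le w).trans (hC β hB g w hw)
  calc |energy D A g - energy D B g|
      = 1 / 2 * |∫ x in D, bilin (A x - B x) (gradL D z x) (gradL D w x)| := by
        rw [hdiff, abs_mul, abs_of_pos one_half_pos]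
    _ ≤ 1 / 2 * (b * ‖gradL D z‖ * ‖gradL D w‖) := by
        gcongr
        exact abs_integral_bilin_le
          (fun i j => (hA.aemeasurable i j).sub (hB.aemeasurable i j)) hb hAB _ _
    _ ≤ 1 / 2 * (b * (C * ‖g‖) * (C * ‖g‖)) := by gcongr
    _ = 1 / 2 * C ^ 2 * b * ‖g‖ ^ 2 := by ring

theorem continuousOn_energy_const (hd : 1 ≤ d) (hD : IsLipschitzDomain D) (hα : 0 < α)
    (β : ℝ) (hg : g ∈ L2m D) :
    ContinuousOn (fun M : Matrix (Fin d) (Fin d) ℝ => energy D (fun _ => M) g)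
      (coeffSet d α β) := by
  obtain ⟨C, hC⟩ := hD.exists_abs_energy_sub_energy_le hd hα
  intro N hN
  have hlim : Tendsto (fun M : Matrix (Fin d) (Fin d) ℝ => C * (∑ i, ∑ j, |(M - N) i j|) * ‖g‖ ^ 2)
      (𝓝[coeffSet d α β] N) (𝓝 0) := by
    have hc : Continuous fun M : Matrix (Fin d) (Fin d) ℝ =>
        C * (∑ i, ∑ j, |(M - N) i j|) * ‖g‖ ^ 2 := by
      simp only [Matrix.sub_apply]
      fun_prop
    simpa using (hc.tendsto N).mono_left nhdsWithin_le_nhds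
  refine tendsto_iff_dist_tendsto_zero.2 (squeeze_zero' (.of_forall fun _ => dist_nonneg) ?_ hlim)
  filter_upwards [self_mem_nhdsWithin] with M hM
  exact hC β (isCoeffField_const _ hM) (isCoeffField_const _ hN) _ (by positivity)
    (.of_forall fun _ => abs_bilin_le_sum (M - N)) g hg

theorem lowerSemicontinuousOn_Psi (hd : 1 ≤ d) (hD : IsLipschitzDomain D) (hα : 0 < α) (β : ℝ)
    (A : EuclideanSpace ℝ (Fin d) → Matrix (Fin d) (Fin d) ℝ) :
    LowerSemicontinuousOn (Psi D A) (coeffSet d α β) := by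
  refine lowerSemicontinuousOn_iSup fun g => lowerSemicontinuousOn_iSup fun hg => ?_
  exact (ENNReal.continuous_ofReal.comp_continuousOn
    (continuousOn_const.sub (hD.continuousOn_energy_const hd hα β hg.1)).abs).lowerSemicontinuousOn

theorem Psi_lt_top (hd : 1 ≤ d) (hD : IsLipschitzDomain D) (hα : 0 < α)
    (hA : IsCoeffField (bulk D) α β A) {M : Matrix (Fin d) (Fin d) ℝ}
    (hM : M ∈ coeffSet d α β) : Psi D A M < ⊤ := by
  obtain ⟨C, hC⟩ := hD.exists_abs_energy_sub_energy_le hd hα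
  have hM' : IsCoeffField (bulk D) α β fun _ => M := isCoeffField_const _ hM
  have hAM : ∀ᵐ x ∂(bulk D), ∀ ξ η : EuclideanSpace ℝ (Fin d),
      |bilin (A x - M) ξ η| ≤ (|β| + |β|) * ‖ξ‖ * ‖η‖ := by
    filter_upwards [hA.abs_bilin_le, hM'.abs_bilin_le] with x hAx hMx ξ η
    rw [bilin_sub_matrix, add_mul, add_mul]
    exact (abs_sub _ _).trans (add_le_add (hAx ξ η) (hMx ξ η))
  refine lt_of_le_of_lt (iSup₂_le fun g hg => ENNReal.ofReal_le_ofReal ?_)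
    (ENNReal.ofReal_lt_top (r := C * (|β| + |β|)))
  simpa [hg.2] using hC β hA hM' _ (by positivity) hAM g hg.1

theorem neZero_bulk (hD : IsLipschitzDomain D) : NeZero (bulk D) :=
  ⟨by simpa using (hD.isOpen.measure_pos volume hD.isConnected.nonempty).ne'⟩

end IsLipschitzDomain

end Energy

end EffectiveCoefficient

end

open EffectiveCoefficient in
theorem proposition2_general {d : ℕ} (hd : 1 ≤ d) {D : Set (EuclideanSpace ℝ (Fin d))}
    (hD : IsLipschitzDomain D) {α β : ℝ} (hα : 0 < α)
    {A : EuclideanSpace ℝ (Fin d) → Matrix (Fin d) (Fin d) ℝ}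
    (hA : IsCoeffField (bulk D) α β A) :
    (∀ g ∈ L2m D, WellPosed D A g ∧ ∀ Abar ∈ coeffSet d α β, WellPosed D (fun _ => Abar) g) ∧
    ∃ Amin ∈ coeffSet d α β,
      Psi D A Amin = (⨅ Abar ∈ coeffSet d α β, Psi D A Abar) ∧ Psi D A Amin < ⊤ := by
  refine ⟨fun g hg => ⟨hD.wellPosed hd hα hA hg, fun M hM =>
    hD.wellPosed hd hα (isCoeffField_const _ hM) hg⟩, ?_⟩
  have := hD.neZero_bulk
  obtain ⟨M, hM, hmin⟩ := (hD.lowerSemicontinuousOn_Psi hd hα β A).exists_isMinOn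
    hA.coeffSet_nonempty (isCompact_coeffSet d α β)
  exact ⟨M, hM, le_antisymm (le_iInf₂ fun N hN => hmin hN) (iInf₂_le M hM),
    hD.Psi_lt_top hd hα hA hM⟩

theorem proposition2 {d : ℕ} (hd : 1 ≤ d) {D : Set (EuclideanSpace ℝ (Fin d))}
    (hD : EffectiveCoefficient.IsLipschitzDomain D) {α β : ℝ} (hα : 0 < α) (hβ : 0 < β)
    {Aper : EuclideanSpace ℝ (Fin d) → Matrix (Fin d) (Fin d) ℝ}
    (hA : EffectiveCoefficient.IsPeriodicCoeff α β Aper) {ε : ℝ} (hε : 0 < ε) :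
    (∀ g ∈ EffectiveCoefficient.L2m D,
      EffectiveCoefficient.WellPosed D (EffectiveCoefficient.rescale Aper ε) g ∧
      ∀ Abar ∈ EffectiveCoefficient.coeffSet d α β,
        EffectiveCoefficient.WellPosed D (fun _ => Abar) g) ∧
    ∃ Amin ∈ EffectiveCoefficient.coeffSet d α β,
      EffectiveCoefficient.Psi D (EffectiveCoefficient.rescale Aper ε) Amin =
        (⨅ Abar ∈ EffectiveCoefficient.coeffSet d α β,
          EffectiveCoefficient.Psi D (EffectiveCoefficient.rescale Aper ε) Abar) ∧
      EffectiveCoefficient.Psi D (EffectiveCoefficient.rescale Aper ε) Amin < ⊤ :=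
  proposition2_general hd hD hα ((hA.isCoeffField_rescale hε.ne').restrict D)
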